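/- Let $n\ge 2$, let $K=\mathbb{C}((\hbar))$ be the field of formal Laurent series and $\overline{K}$ its algebraic closure. Let $\alpha_i=\varepsilon_i-\varepsilon_{i+1}$ ($1\le i\le n-1$) be the simple roots of $\mathfrak{sl}_n$ with respect to the Cartan subalgebra $\mathfrak h$ of traceless diagonal matrices, and let $(\Gamma_1,\Gamma_2,\tau)$ be an admissible triple: $\Gamma_1,\Gamma_2$ are sets of simple roots, $\tau:\Gamma_1\to\Gamma_2$ is an isometric bijection, and for every $\alpha\in\Gamma_1$ there is $k\ge 1$ such that $\tau^k(\alpha)$ is defined and lies in $\Gamma_2\setminus\Gamma_1$. Let $r$ be a Belavin–Drinfeld $r$-matrix over $\overline K$ for this triple, i.e. $$r=r_0+\sum_{\alpha>0}e_{-\alpha}\otimes e_\alpha+\sum_{\alpha\in\mathrm{Span}(\Gamma_1)^+}\ \sum_{k\ge 1}e_{-\alpha}\wedge e_{\tau^k(\alpha)},\qquad a\wedge b=a\otimes b-b\otimes a,$$ where the inner sum is over those $k$ for which $\tau^k(\alpha)$ is defined ($\tau$ being extended linearly to $\mathrm{Span}(\Gamma_1)$). Here the $e_\alpha$ are root vectors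 with $\mathrm{tr}(e_\alpha e_{-\alpha})=1$ such that $e_\alpha\mapsto e_{\tau(\alpha)}$, $\alpha\in\mathrm{Span}(\Gamma_1)^+$, preserves Lie brackets. The tensor $r_0\in\mathfrak h\otimes\mathfrak h$ (over $\overline K$) satisfies $r_0+r_0^{21}=\sum_k t_k\otimes t_k$, with $(t_k)$ an orthonormal basis of $\mathfrak h$ for the trace form, and $(\tau(\alpha)\otimes\mathrm{id}+\mathrm{id}\otimes\alpha)r_0=0$ for all $\alpha\in\Gamma_1$. For $G=GL(n)$ or $SL(n)$ let $C(G,r)=\{X\in G(\overline K): (\mathrm{Ad}_X\otimes\mathrm{Ad}_X)r=r\}$. A (non-twisted Belavin–Drinfeld) cocycle is an $X\in SL(n,\overline K)$ with $X^{-1}\sigma(X)\in C(SL(n),r)$ for all $\sigma\in\mathrm{Gal}(\overline K/K)$. Cocycles $X_1,X_2$ are equivalent if $X_1=QX_2C$ for some $Q\in SL(n,K)$ and $C\in C(SL(n),r)$. The set of equivalence classes is $H^1_{BD}(SL(n),r)$. The strings of $\tau$ are the sets $\{\alpha,\tau(\alpha),\dots,\tau^k(\alpha)\}$ with $\alpha\in\Gamma_1\setminus\Gamma_2$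 and $\tau^k(\alpha)\in\Gamma_2\setminus\Gamma_1$, together with the singletons $\{\alpha\}$ for simple roots $\alpha\notin\Gamma_1\cup\Gamma_2$. The weight of a string is the sum of the indices $i$ of its elements $\alpha_i$. Let $N$ be the greatest common divisor of $n$ and the weights of all strings of $\tau$. Then: 1. $H^1_{BD}(SL(n),r)$ has exactly $N$ elements. 2. Each cohomology class contains a diagonal matrix $D=A_1A_2$ with $A_1$ an invertible diagonal matrix over $K$ and $A_2\in C(GL(n),r)$. 3. If $D_1=A_1A_2$ and $D_2=B_1B_2$ are matrices in $SL(n,\overline K)$ with $A_1,B_1$ invertible diagonal matrices over $K$ and $A_2,B_2\in C(GL(n),r)$, then $D_1$ and $D_2$ are cocycles, and they lie in the same class of $H^1_{BD}(SL(n),r)$ if and only if $\det A_1=\det B_1$ in $K^*/(K^*)^N$. -/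

import Mathlib

open scoped TensorProduct

noncomputable section

namespace BelavinDrinfeld

/-- The vector `ε_i - ε_j` of `ℤⁿ`; for `i ≠ j` these are the roots of `sl_n`, and the positive
roots are those with `i < j`. -/
def root {n : ℕ} (i j : Fin n) : Fin n → ℤ := Pi.single i 1 - Pi.single j 1

/-- The simple roots of `sl_n`. The index `a : Fin (n - 1)` starts at `0`, so that `simpleRoot a`
is the root usually called `α_{a+1}`. -/
def simpleRoot {n : ℕ} (a : Fin (n - 1)) : Fin n → ℤ :=
  root ⟨a, by have := a.isLt; omega⟩ ⟨a + 1, by have := a.isLt; omega⟩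

/-- Admissible triples `(Γ₁, Γ₂, τ)` for `sl_n`: `τ : Γ₁ → Γ₂` is an isometric bijection between
sets of simple roots, and every element of `Γ₁` is moved into `Γ₂ \ Γ₁` by some iterate of `τ`. -/
structure AdmissibleTriple (n : ℕ) where
  Γ₁ : Finset (Fin (n - 1))
  Γ₂ : Finset (Fin (n - 1))
  τ : Γ₁ ≃ Γ₂
  isometry : ∀ a b : Γ₁,
    simpleRoot (τ a).1 ⬝ᵥ simpleRoot (τ b).1 = simpleRoot a.1 ⬝ᵥ simpleRoot b.1
  nilpotent : ∀ a ∈ Γ₁, ∃ b ∈ Γ₂, b ∉ Γ₁ ∧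
    Relation.TransGen (fun x y => ∃ h : x ∈ Γ₁, (τ ⟨x, h⟩).1 = y) a b

namespace AdmissibleTriple

variable {n : ℕ} (T : AdmissibleTriple n)

/-- `τ(α_a)` is defined and equal to `α_b`. -/
def simpleStep (a b : Fin (n - 1)) : Prop := ∃ h : a ∈ T.Γ₁, (T.τ ⟨a, h⟩).1 = b

/-- The positive root `p` lies in `Span(Γ₁)⁺`, and the linear extension of `τ` to the span of `Γ₁`
sends it to the positive root `q`. -/
def rootStep (p q : Fin n × Fin n) : Prop :=
  p.1 < p.2 ∧ q.1 < q.2 ∧ ∃ c : T.Γ₁ → ℕ,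
    root p.1 p.2 = ∑ a, c a • simpleRoot a.1 ∧
    root q.1 q.2 = ∑ a, c a • simpleRoot (T.τ a).1

open Classical in
/-- The string `{α_a, τ(α_a), τ²(α_a), …}` that starts at `α_a`. The starting points of strings are
the `a ∉ Γ₂`; for `a ∉ Γ₁ ∪ Γ₂` the string is `{α_a}`. -/
def stringFrom (a : Fin (n - 1)) : Finset (Fin (n - 1)) :=
  Finset.univ.filter (fun b => Relation.ReflTransGen T.simpleStep a b)

/-- The weight of a string: the sum of the (usual, starting at `1`) indices of its elements. -/
def weightFrom (a : Fin (n - 1)) : ℕ := ∑ b ∈ T.stringFrom a, (b.1 + 1)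

/-- The greatest common divisor of `n` (the weight of the formal string `{α_n}`) and of the weights
of all strings of `τ`. -/
def stringGcd : ℕ := Nat.gcd n (T.Γ₂ᶜ.gcd T.weightFrom)

end AdmissibleTriple

section RMatrix

variable (F : Type*) [Field F] (n : ℕ)

/-- The Cartan subalgebra of `sl_n(F)`: diagonal matrices of trace `0`. -/
def cartan : Submodule F (Matrix (Fin n) (Fin n) F) where
  carrier := {A | A.IsDiag ∧ A.trace = 0}
  add_mem' := by
    rintro A B ⟨hA, hA'⟩ ⟨hB, hB'⟩
    exact ⟨hA.add hB, by simp [Matrix.trace_add, hA', hB']⟩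
  zero_mem' := ⟨Matrix.isDiag_zero, by simp⟩
  smul_mem' := by
    rintro c A ⟨hA, hA'⟩
    exact ⟨hA.smul c, by simp [Matrix.trace_smul, hA']⟩

variable {F n}

/-- An integral vector `v` as the linear functional `diag(d) ↦ ∑ v_i d_i` on the Cartan
subalgebra. -/
def weightFunctional (v : Fin n → ℤ) : cartan F n →ₗ[F] F where
  toFun A := ∑ i, (v i : F) * A.1 i i
  map_add' A B := by simp [mul_add, Finset.sum_add_distrib]
  map_smul' c A := by
    simp only [Submodule.coe_smul, Matrix.smul_apply, smul_eq_mul, RingHom.id_apply,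
      Finset.mul_sum]
    exact Finset.sum_congr rfl fun i _ => by ring

/-- `a ∧ b = a ⊗ b - b ⊗ a`. -/
def wedge (a b : Matrix (Fin n) (Fin n) F) :
    Matrix (Fin n) (Fin n) F ⊗[F] Matrix (Fin n) (Fin n) F :=
  a ⊗ₜ[F] b - b ⊗ₜ[F] a

/-- The root vector `e_α = c_{ij} E_{ij}` for the root `α = ε_i - ε_j`. -/
def rootVector (c : Fin n → Fin n → F) (i j : Fin n) : Matrix (Fin n) (Fin n) F :=
  Matrix.single i j (c i j)

/-- The root vectors `e_α` are normalized by `tr (e_α e_{-α}) = 1`, and they are compatible with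
`τ`: the map `e_α ↦ e_{τ(α)}`, `α ∈ Span(Γ₁)⁺`, preserves the Lie bracket (so that `τ` is
implemented by an isomorphism of the subalgebras generated by `e_{±α}`, `α ∈ Γ₁`, respectively
`α ∈ Γ₂`). -/
def IsRootSystemBasis (T : AdmissibleTriple n) (c : Fin n → Fin n → F) : Prop :=
  (∀ i j, i ≠ j → (rootVector c i j * rootVector c j i).trace = 1) ∧
  ∀ p q s p' q' s' : Fin n × Fin n, T.rootStep p p' → T.rootStep q q' → T.rootStep s s' →
    ∀ N : F, ⁅rootVector c p.1 p.2, rootVector c q.1 q.2⁆ = N • rootVector c s.1 s.2 →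
      ⁅rootVector c p'.1 p'.2, rootVector c q'.1 q'.2⁆ = N • rootVector c s'.1 s'.2

/-- The conditions on the Cartan part `r₀ ∈ 𝔥 ⊗ 𝔥`: `r₀ + r₀²¹ = ∑ t_k ⊗ t_k` for an orthonormal
basis `t` of `𝔥` with respect to the trace form, and `(τ(α) ⊗ id + id ⊗ α) r₀ = 0` for
`α ∈ Γ₁`. -/
def IsCartanPart (T : AdmissibleTriple n) (r₀ : cartan F n ⊗[F] cartan F n) : Prop :=
  (∃ t : Module.Basis (Fin (n - 1)) F (cartan F n),
    (∀ k l, ((t k).1 * (t l).1).trace = if k = l then 1 else 0) ∧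
    r₀ + TensorProduct.comm F (cartan F n) (cartan F n) r₀ = ∑ k, t k ⊗ₜ[F] t k) ∧
  ∀ a : T.Γ₁,
    TensorProduct.lid F (cartan F n)
        ((weightFunctional (simpleRoot (T.τ a).1)).rTensor (cartan F n) r₀) +
      TensorProduct.rid F (cartan F n)
        ((weightFunctional (simpleRoot a.1)).lTensor (cartan F n) r₀) = 0

open Classical in
/-- `r` is a Belavin–Drinfeld `r`-matrix with admissible triple `T`:
`r = r₀ + ∑_{α > 0} e_{-α} ⊗ e_α + ∑_{α ∈ Span(Γ₁)⁺} ∑_{k ≥ 1} e_{-α} ∧ e_{τ^k(α)}`.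
The last double sum is written as a sum over the pairs `(α, β)` with `β = τ^k(α)` for some
`k ≥ 1`; no iterate of `τ` has a fixed point, so `k` is determined by the pair. The tensor `r` lies
in `sl_n ⊗ sl_n`, which is viewed inside the tensor square of the algebra of all matrices. -/
def IsBDMatrix (T : AdmissibleTriple n)
    (r : Matrix (Fin n) (Fin n) F ⊗[F] Matrix (Fin n) (Fin n) F) : Prop :=
  ∃ (r₀ : cartan F n ⊗[F] cartan F n) (c : Fin n → Fin n → F),
    IsCartanPart T r₀ ∧ IsRootSystemBasis T c ∧
    r = TensorProduct.map (cartan F n).subtype (cartan F n).subtype r₀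
      + ∑ p : Fin n × Fin n with p.1 < p.2, rootVector c p.2 p.1 ⊗ₜ[F] rootVector c p.1 p.2
      + ∑ pq : (Fin n × Fin n) × (Fin n × Fin n) with Relation.TransGen T.rootStep pq.1 pq.2,
          wedge (rootVector c pq.1.2 pq.1.1) (rootVector c pq.2.1 pq.2.2)

/-- `Ad_X ⊗ Ad_X`, where `Ad_X A = X A X⁻¹`. -/
def adTensor (X : GL (Fin n) F) :
    Matrix (Fin n) (Fin n) F ⊗[F] Matrix (Fin n) (Fin n) F →ₗ[F]
      Matrix (Fin n) (Fin n) F ⊗[F] Matrix (Fin n) (Fin n) F :=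
  TensorProduct.map (LinearMap.mulLeftRight F (X.1, (X⁻¹).1))
    (LinearMap.mulLeftRight F (X.1, (X⁻¹).1))

theorem adTensor_one : adTensor (1 : GL (Fin n) F) = LinearMap.id := by
  refine TensorProduct.ext' fun a b => ?_
  simp [adTensor, LinearMap.mulLeftRight_apply]

theorem adTensor_mul (X Y : GL (Fin n) F) :
    adTensor (X * Y) = adTensor X ∘ₗ adTensor Y := by
  refine TensorProduct.ext' fun a b => ?_
  simp only [adTensor, TensorProduct.map_tmul, LinearMap.mulLeftRight_apply, LinearMap.comp_apply,
    mul_inv_rev, Units.val_mul, mul_assoc]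

/-- The centralizer `C(GL(n), r)`: all invertible `X` with `Ad_X r = r`. -/
def centralizerGL (r : Matrix (Fin n) (Fin n) F ⊗[F] Matrix (Fin n) (Fin n) F) :
    Subgroup (GL (Fin n) F) where
  carrier := {X | adTensor X r = r}
  one_mem' := by simp [adTensor_one]
  mul_mem' := by
    intro X Y (hX : adTensor X r = r) (hY : adTensor Y r = r)
    simp [adTensor_mul, hX, hY]
  inv_mem' := by
    intro X (hX : adTensor X r = r)
    have h := congrArg (fun f => f r) (adTensor_mul X⁻¹ X)
    simp only [inv_mul_cancel, adTensor_one, LinearMap.id_apply, LinearMap.comp_apply, hX] at h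
    exact h.symm

/-- The centralizer `C(SL(n), r)`. -/
def centralizerSL (r : Matrix (Fin n) (Fin n) F ⊗[F] Matrix (Fin n) (Fin n) F) :
    Subgroup (Matrix.SpecialLinearGroup (Fin n) F) :=
  (centralizerGL r).comap Matrix.SpecialLinearGroup.toGL

end RMatrix

/-- The subgroup `(Fˣ)^N` of `N`-th powers in the multiplicative group of a field. -/
def powerSubgroup (F : Type*) [Field F] (N : ℕ) : Subgroup Fˣ :=
  (powMonoidHom N : Fˣ →* Fˣ).range

section Cohomology

variable (F : Type*) {L : Type*} [Field F] [Field L] [Algebra F L] {n : ℕ}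
  (r : Matrix (Fin n) (Fin n) L ⊗[L] Matrix (Fin n) (Fin n) L)

/-! Belavin–Drinfeld cohomology for a field `F` with an extension `L`, to be applied to
`F = ℂ((ℏ))` and its algebraic closure. -/

/-- The non-twisted Belavin–Drinfeld cocycles `Z(SL(n), r)`: all `X ∈ SL(n, L)`
such that `X⁻¹ σ(X) ∈ C(SL(n), r)` for every `σ` in `Gal(L/F)`. -/
def cocycles : Set (Matrix.SpecialLinearGroup (Fin n) L) :=
  {X | ∀ σ : L ≃ₐ[F] L,
    X⁻¹ * Matrix.SpecialLinearGroup.map (σ : L →+* L) X ∈ centralizerSL r}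

/-- Equivalence of cocycles: `X₁ = Q X₂ C` with `Q ∈ SL(n, F)` and `C ∈ C(SL(n), r)`. -/
def cocycleSetoid : Setoid (cocycles F r) where
  r X₁ X₂ := ∃ Q : Matrix.SpecialLinearGroup (Fin n) F, ∃ C ∈ centralizerSL r,
    X₁.1 = Matrix.SpecialLinearGroup.map (algebraMap F L) Q * X₂.1 * C
  iseqv :=
    { refl := fun X => ⟨1, 1, one_mem _, by simp⟩
      symm := by
        rintro X Y ⟨Q, C, hC, h⟩
        refine ⟨Q⁻¹, C⁻¹, inv_mem hC, ?_⟩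
        rw [h, map_inv]
        group
      trans := by
        rintro X Y Z ⟨Q, C, hC, h⟩ ⟨Q', C', hC', h'⟩
        refine ⟨Q * Q', C' * C, mul_mem hC' hC, ?_⟩
        rw [h, h', map_mul]
        group }

/-- The non-twisted Belavin–Drinfeld cohomology `H¹_BD(SL(n), r)`. -/
def Cohomology : Type _ := Quotient (cocycleSetoid F r)

/-- The cohomology class of a cocycle. -/
def cohomologyClass (X : Matrix.SpecialLinearGroup (Fin n) L) (hX : X ∈ cocycles F r) :
    Cohomology F r :=
  Quotient.mk (cocycleSetoid F r) ⟨X, hX⟩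

variable {F} in
/-- `D = A₁ A₂` with `A₁` diagonal over `F` (invertible, as `D` is) and
`A₂ ∈ C(GL(n), r)`. -/
def IsFactorization (D : Matrix.SpecialLinearGroup (Fin n) L) (A₁ : GL (Fin n) F)
    (A₂ : GL (Fin n) L) : Prop :=
  A₁.1.IsDiag ∧ A₂ ∈ centralizerGL r ∧
    Matrix.SpecialLinearGroup.toGL D =
      Matrix.GeneralLinearGroup.map (algebraMap F L) A₁ * A₂

end Cohomology

/-- The field `ℂ((ℏ))` of formal Laurent series. -/
abbrev K : Type := LaurentSeries ℂ

/-- The algebraic closure of `ℂ((ℏ))`. -/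
abbrev Kbar : Type := AlgebraicClosure K

end BelavinDrinfeld

end

open scoped TensorProduct

noncomputable section

namespace BelavinDrinfeld

/-! The tensor `r` is read as the operator `R(x) = ∑ tr(a x) b` on matrices, and `X` in `C(GL(n),
r)` makes `R` commute with conjugation by `X`. On strictly lower matrices `R` moves root vectors
only backwards along `τ`, and on strictly upper ones `R - 1` moves them only forwards; both are
nilpotent because `τ` has no cycles. Hence conjugation by `X` creates no upper entries from lower
root vectors and no lower entries from upper ones, which forces `X` to be diagonal. A diagonal
`diag(t)` centralizes `r` exactly when `α(t) = τ(α)(t)` for `α ∈ Γ₁`, that is, when `t` is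
`compatible` (`IsBDMatrix.mem_centralizerGL_iff`).

For a cocycle `X`, the Galois group therefore only rescales columns. Dividing each column by a
nonzero entry gives `X = Q d` with `Q` rational and `d` diagonal. The Galois group multiplies the
simple root values of `d` by factors constant on strings, so dividing by the values at the string
starts leaves a rational tuple: `d = s t` with `s` rational and `t` compatible. This proves the
second claim.

Two such products are equivalent iff the quotient of the determinants of their rational parts is the
product of the entries of a compatible tuple over `F` (`equivalent_iff_exists_compatible`). A tuple
with last entry `v` and ratios `u_a` has product `v ^ n * ∏ u_a ^ a` (with `a` counted from `1`). If
the `u_a` are constant on strings, the exponents add up to string weights, so by Bézout these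
products are precisely the `N`-th powers (`exists_mem_compatible_prod_eq`). Finally `Kˣ / (Kˣ)^N`
has `N` elements, the order modulo `N` being the only invariant. -/

/-- The first index `a` of the simple root `α_a = ε_a - ε_{a+1}`. -/
def lo {n : ℕ} (a : Fin (n - 1)) : Fin n := ⟨a, by have := a.isLt; omega⟩

/-- The second index `a + 1` of the simple root `α_a = ε_a - ε_{a+1}`. -/
def hi {n : ℕ} (a : Fin (n - 1)) : Fin n := ⟨a + 1, by have := a.isLt; omega⟩

theorem simpleRoot_eq {n : ℕ} (a : Fin (n - 1)) : simpleRoot a = root (lo a) (hi a) := rfl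

theorem lo_lt_hi {n : ℕ} (a : Fin (n - 1)) : lo a < hi a := by
  simp [lo, hi, Fin.lt_def]

/-! ### Strings of `τ` and acyclicity of `τ` on simple and positive roots. -/

namespace AdmissibleTriple

variable {n : ℕ} (T : AdmissibleTriple n)

theorem simpleStep_tau (a : T.Γ₁) : T.simpleStep a (T.τ a) := ⟨a.2, rfl⟩

theorem simpleStep.right_unique {T : AdmissibleTriple n} {a b b' : Fin (n - 1)}
    (h : T.simpleStep a b) (h' : T.simpleStep a b') : b = b' := by
  obtain ⟨_, rfl⟩ := h
  obtain ⟨_, rfl⟩ := h'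
  rfl

theorem simpleStep.left_unique {T : AdmissibleTriple n} {a a' b : Fin (n - 1)}
    (h : T.simpleStep a b) (h' : T.simpleStep a' b) : a = a' := by
  obtain ⟨_, rfl⟩ := h
  obtain ⟨_, h'⟩ := h'
  simpa using (T.τ.injective (Subtype.ext h')).symm

theorem simpleStep.mem_right {T : AdmissibleTriple n} {a b : Fin (n - 1)}
    (h : T.simpleStep a b) : b ∈ T.Γ₂ := by
  obtain ⟨_, rfl⟩ := h
  exact (T.τ _).2

/-- The chain ends at `b`, which has no successor, and successors are unique, so accessibility
propagates back to `a`. -/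
theorem acc_of_transGen {a b : Fin (n - 1)} (hb : b ∉ T.Γ₁)
    (h : Relation.TransGen T.simpleStep a b) : Acc (flip T.simpleStep) a := by
  have hb' : Acc (flip T.simpleStep) b := ⟨_, fun c hc => absurd hc.1 hb⟩
  induction h using Relation.TransGen.head_induction_on with
  | single h => exact ⟨_, fun c hc => h.right_unique hc ▸ hb'⟩
  | head h _ ih => exact ⟨_, fun c hc => h.right_unique hc ▸ ih⟩

theorem wellFounded_flip_simpleStep : WellFounded (flip T.simpleStep) := by
  refine ⟨fun a => ?_⟩
  by_cases ha : a ∈ T.Γ₁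
  · obtain ⟨b, _, hb, h⟩ := T.nilpotent a ha
    exact T.acc_of_transGen hb h
  · exact ⟨_, fun c hc => absurd hc.1 ha⟩

/-- A cycle would be an infinite forward chain, contradicting nilpotency. -/
theorem not_transGen_self (a : Fin (n - 1)) : ¬ Relation.TransGen T.simpleStep a a := by
  intro h
  have hw := T.wellFounded_flip_simpleStep.transGen
  rw [← Relation.transGen_swap] at h
  exact hw.irrefl.irrefl a h

theorem wellFounded_simpleStep : WellFounded T.simpleStep := by
  have : Std.Irrefl (Relation.TransGen T.simpleStep) := ⟨T.not_transGen_self⟩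
  have hw := Finite.wellFounded_of_trans_of_irrefl (Relation.TransGen T.simpleStep)
  exact Subrelation.wf (fun h => Relation.TransGen.single h) hw

/-- Walking back along `τ⁻¹` must stop, and it can only stop outside `Γ₂`. -/
theorem exists_start (b : Fin (n - 1)) :
    ∃ a, a ∉ T.Γ₂ ∧ Relation.ReflTransGen T.simpleStep a b := by
  induction b using T.wellFounded_simpleStep.induction with
  | _ b ih =>
    by_cases hb : b ∈ T.Γ₂
    · have hs : T.simpleStep (T.τ.symm ⟨b, hb⟩) b := ⟨(T.τ.symm ⟨b, hb⟩).2, by simp⟩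
      obtain ⟨a, ha, h⟩ := ih _ hs
      exact ⟨a, ha, h.tail hs⟩
    · exact ⟨b, hb, .refl⟩

/-- The index at which the string through `α_b` starts. -/
def start (b : Fin (n - 1)) : Fin (n - 1) := (T.exists_start b).choose

theorem start_notMem (b : Fin (n - 1)) : T.start b ∉ T.Γ₂ := (T.exists_start b).choose_spec.1

theorem reflTransGen_start (b : Fin (n - 1)) :
    Relation.ReflTransGen T.simpleStep (T.start b) b := (T.exists_start b).choose_spec.2

theorem start_unique {T : AdmissibleTriple n} {a a' b : Fin (n - 1)} (ha : a ∉ T.Γ₂)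
    (ha' : a' ∉ T.Γ₂)
    (h : Relation.ReflTransGen T.simpleStep a b) (h' : Relation.ReflTransGen T.simpleStep a' b) :
    a = a' := by
  induction h with
  | refl =>
    rcases h'.cases_tail with h | ⟨c, _, hc⟩
    · exact h
    · exact absurd hc.mem_right ha
  | tail _ hs ih =>
    rcases h'.cases_tail with h | ⟨c, hc, hc'⟩
    · exact absurd (h ▸ hs.mem_right) ha'
    · exact ih (hs.left_unique hc' ▸ hc)

theorem start_eq_iff {a b : Fin (n - 1)} (ha : a ∉ T.Γ₂) :
    T.start b = a ↔ b ∈ T.stringFrom a := by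
  simp only [stringFrom, Finset.mem_filter, Finset.mem_univ, true_and]
  exact ⟨fun h => h ▸ T.reflTransGen_start b,
    fun h => start_unique (T.start_notMem b) ha (T.reflTransGen_start b) h⟩

theorem start_tau (a : T.Γ₁) : T.start (T.τ a) = T.start a :=
  start_unique (T.start_notMem _) (T.start_notMem _) (T.reflTransGen_start _)
    ((T.reflTransGen_start a.1).tail (T.simpleStep_tau a))

/-- A function on simple roots that is `τ`-invariant is constant on strings. -/
theorem apply_start {G : Type*} {u : Fin (n - 1) → G} (hu : ∀ a : T.Γ₁, u (T.τ a) = u a)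
    (b : Fin (n - 1)) : u (T.start b) = u b := by
  have key : ∀ a, Relation.ReflTransGen T.simpleStep a b → u a = u b := by
    intro a h
    induction h with
    | refl => rfl
    | tail _ h ih =>
      obtain ⟨h, rfl⟩ := h
      rw [ih, hu ⟨_, h⟩]
  exact key _ (T.reflTransGen_start b)

open Classical in
/-- The number of simple roots `τ^k(α_a)`, `k ≥ 1`. -/
def height (a : Fin (n - 1)) : ℕ :=
  (Finset.univ.filter fun b => Relation.TransGen T.simpleStep a b).card

/-- Everything reachable from `τ(a)` is reachable from `a`, while `τ(a)` itself is reachable from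
`a` but not from itself. -/
theorem height_tau_lt (a : T.Γ₁) : T.height (T.τ a) < T.height a := by
  classical
  refine Finset.card_lt_card (Finset.ssubset_iff.2 ⟨T.τ a, ?_, fun c hc => ?_⟩)
  · simpa using T.not_transGen_self _
  · rcases Finset.mem_insert.1 hc with rfl | hc
    · simpa using .single (T.simpleStep_tau a)
    · simpa using .head (T.simpleStep_tau a) (by simpa using hc)

/-- The additive function on the root lattice that extends `height`. -/
def rootHeight (v : Fin n → ℤ) : ℤ :=
  ∑ i, v i * ∑ a : Fin (n - 1) with i.1 ≤ a.1, (T.height a : ℤ)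

theorem rootHeight_sum {ι : Type*} (s : Finset ι) (c : ι → ℕ) (v : ι → Fin n → ℤ) :
    T.rootHeight (∑ a ∈ s, c a • v a) = ∑ a ∈ s, c a * T.rootHeight (v a) := by
  simp only [rootHeight, Finset.sum_apply, nsmul_eq_mul, Finset.sum_mul]
  rw [Finset.sum_comm]
  simp only [Pi.mul_apply, Pi.natCast_apply, mul_assoc, Finset.mul_sum]

end AdmissibleTriple

theorem filter_lo_le {n : ℕ} (a : Fin (n - 1)) :
    (Finset.univ.filter fun j : Fin (n - 1) => (lo a).1 ≤ j.1) =
      insert a (Finset.univ.filter fun j : Fin (n - 1) => (hi a).1 ≤ j.1) := by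
  ext j
  simp only [Finset.mem_filter, Finset.mem_univ, true_and, Finset.mem_insert, Fin.ext_iff]
  change a.1 ≤ j.1 ↔ j.1 = a.1 ∨ a.1 + 1 ≤ j.1
  omega

theorem notMem_filter_hi_le {n : ℕ} (a : Fin (n - 1)) :
    a ∉ Finset.univ.filter fun j : Fin (n - 1) => (hi a).1 ≤ j.1 := by
  simp [hi]

namespace AdmissibleTriple

variable {n : ℕ} (T : AdmissibleTriple n)

theorem rootHeight_simpleRoot (a : Fin (n - 1)) : T.rootHeight (simpleRoot a) = T.height a := by
  simp only [rootHeight, simpleRoot_eq, root, Pi.sub_apply, sub_mul, Finset.sum_sub_distrib,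
    Pi.single_apply, ite_mul, one_mul, zero_mul, Finset.sum_ite_eq', Finset.mem_univ, if_true]
  rw [filter_lo_le, Finset.sum_insert (notMem_filter_hi_le a)]
  ring

/-- The root is a nonnegative combination of `Γ₁`, not all coefficients vanish, and every simple
root occurring in it loses height. This excludes cycles of `rootStep` and justifies the inductions
over positive roots used for the centralizer. -/
theorem rootStep.rootHeight_lt {T : AdmissibleTriple n} {p q : Fin n × Fin n}
    (h : T.rootStep p q) : T.rootHeight (root q.1 q.2) < T.rootHeight (root p.1 p.2) := by
  obtain ⟨hp, _, c, hc, hc'⟩ := h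
  rw [hc, hc', rootHeight_sum, rootHeight_sum]
  simp only [rootHeight_simpleRoot]
  refine Finset.sum_lt_sum (fun a _ => ?_) ?_
  · have := T.height_tau_lt a
    gcongr
  · by_contra! H
    have h0 : ∀ a, c a = 0 := by
      intro a
      have h1 := T.height_tau_lt a
      by_contra h2
      have h3 := H a (Finset.mem_univ a)
      have h4 : (0 : ℤ) < c a := by exact_mod_cast Nat.pos_of_ne_zero h2
      have h5 : (T.height (T.τ a) : ℤ) < T.height a := by exact_mod_cast h1
      nlinarith
    have := congrFun hc p.1
    simp [h0, root, hp.ne] at this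

theorem rootHeight_lt_of_transGen {T : AdmissibleTriple n} {p q : Fin n × Fin n}
    (h : Relation.TransGen T.rootStep p q) :
    T.rootHeight (root q.1 q.2) < T.rootHeight (root p.1 p.2) := by
  induction h with
  | single h => exact h.rootHeight_lt
  | tail _ h ih => exact h.rootHeight_lt.trans ih

theorem wellFounded_transGen_rootStep : WellFounded (Relation.TransGen T.rootStep) := by
  have : Std.Irrefl (Relation.TransGen T.rootStep) :=
    ⟨fun _ h => (rootHeight_lt_of_transGen h).false⟩
  exact Finite.wellFounded_of_trans_of_irrefl _

theorem wellFounded_flip_transGen_rootStep : WellFounded (flip (Relation.TransGen T.rootStep)) := by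
  have : Std.Irrefl (flip (Relation.TransGen T.rootStep)) :=
    ⟨fun _ h => (rootHeight_lt_of_transGen h).false⟩
  have : IsTrans _ (flip (Relation.TransGen T.rootStep)) := ⟨fun _ _ _ h h' => h'.trans h⟩
  exact Finite.wellFounded_of_trans_of_irrefl _

theorem lt_of_transGen_rootStep {T : AdmissibleTriple n} {p q : Fin n × Fin n}
    (h : Relation.TransGen T.rootStep p q) : p.1 < p.2 ∧ q.1 < q.2 := by
  induction h with
  | single h => exact ⟨h.1, h.2.1⟩
  | tail _ h ih => exact ⟨ih.1, h.2.1⟩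

theorem rootStep_simple (a : T.Γ₁) :
    T.rootStep (lo a.1, hi a.1) (lo (T.τ a).1, hi (T.τ a).1) := by
  classical
  refine ⟨lo_lt_hi _, lo_lt_hi _, Pi.single a 1, ?_, ?_⟩
  · rw [Finset.sum_eq_single a] <;> simp +contextual [simpleRoot_eq]
  · rw [Finset.sum_eq_single a] <;> simp +contextual [simpleRoot_eq]

end AdmissibleTriple

/-! ### Tuples described by their simple root values, and the products of compatible tuples. -/

section Ratios

variable {n : ℕ} {G : Type*} [CommGroup G]

/-- The `n`-tuple with last entry `v` and with `t_a / t_{a+1} = u_a`. -/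
def ofRatios (v : G) (u : Fin (n - 1) → G) (i : Fin n) : G :=
  v * ∏ j : Fin (n - 1) with i.1 ≤ j.1, u j

theorem ofRatios_lo_div_hi (v : G) (u : Fin (n - 1) → G) (a : Fin (n - 1)) :
    ofRatios v u (lo a) / ofRatios v u (hi a) = u a := by
  rw [ofRatios, ofRatios, filter_lo_le, Finset.prod_insert (notMem_filter_hi_le a)]
  simp

theorem exists_eq_ofRatios (hn : 0 < n) (t : Fin n → G) :
    t = ofRatios (t ⟨n - 1, by omega⟩) fun a => t (lo a) / t (hi a) := by
  have key : ∀ k (i : Fin n), i.1 + k = n - 1 →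
      t i = ofRatios (t ⟨n - 1, by omega⟩) (fun a => t (lo a) / t (hi a)) i := by
    intro k
    induction k with
    | zero =>
      intro i hin
      have hi' : i = ⟨n - 1, by omega⟩ := Fin.ext hin
      rw [hi', ofRatios, Finset.filter_false_of_mem]
      · simp
      · intro j _
        have := j.isLt
        simp only [not_le]
        omega
    | succ k ih =>
      intro i hik
      have h := ofRatios_lo_div_hi (t ⟨n - 1, by omega⟩) (fun a => t (lo a) / t (hi a))
        ⟨i.1, by omega⟩
      rw [← ih (hi _) (by change i.1 + 1 + k = n - 1; omega)] at h
      exact (div_left_injective h).symm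
  exact funext fun i => key (n - 1 - i.1) i (by omega)

/-- The ratio `u_a` enters the entries with index at most `a`, and with indices from `0` there are
`a + 1` of them. -/
theorem prod_ofRatios (v : G) (u : Fin (n - 1) → G) :
    ∏ i, ofRatios v u i = v ^ n * ∏ a, u a ^ (a.1 + 1) := by
  simp only [ofRatios, Finset.prod_mul_distrib, Finset.prod_const, Finset.card_univ,
    Fintype.card_fin]
  congr 1
  rw [Finset.prod_comm' (t' := Finset.univ)
    (s' := fun j => Finset.univ.filter fun i : Fin n => i.1 ≤ j.1) (by simp)]
  refine Finset.prod_congr rfl fun j _ => ?_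
  rw [Finset.prod_const]
  congr 1
  have : (Finset.univ.filter fun i : Fin n => i.1 ≤ j.1) = Finset.Iic (lo j) := by
    ext i
    simp [lo, Fin.le_def]
  rw [this, Fin.card_Iic]
  rfl

/-- The tuples `t` with `α(t) = τ(α)(t)` for `α ∈ Γ₁`. -/
def compatible (T : AdmissibleTriple n) (G : Type*) [CommGroup G] : Subgroup (Fin n → G) where
  carrier := {t | ∀ a : T.Γ₁, t (lo (T.τ a).1) / t (hi (T.τ a).1) = t (lo a.1) / t (hi a.1)}
  one_mem' := by simp
  mul_mem' := by
    intro s t hs ht a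
    simp only [Pi.mul_apply, mul_div_mul_comm, hs a, ht a]
  inv_mem' := by
    intro s hs a
    simp only [Pi.inv_apply, inv_div_inv, ← inv_div (s (lo _)), hs a]

theorem mem_compatible {T : AdmissibleTriple n} {t : Fin n → G} :
    t ∈ compatible T G ↔
      ∀ a : T.Γ₁, t (lo (T.τ a).1) / t (hi (T.τ a).1) = t (lo a.1) / t (hi a.1) := Iff.rfl

theorem ofRatios_mem_compatible {T : AdmissibleTriple n} (v : G) {u : Fin (n - 1) → G}
    (hu : ∀ a : T.Γ₁, u (T.τ a) = u a) : ofRatios v u ∈ compatible T G := by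
  intro a
  rw [ofRatios_lo_div_hi, ofRatios_lo_div_hi, hu]

/-- Every index lies in the string of its `start`, where `u` is constant, so the exponents in one
string add up to its weight. -/
theorem prod_pow_eq_prod_weight (T : AdmissibleTriple n) {u : Fin (n - 1) → G}
    (hu : ∀ a : T.Γ₁, u (T.τ a) = u a) :
    ∏ a, u a ^ (a.1 + 1) = ∏ a ∈ T.Γ₂ᶜ, u a ^ T.weightFrom a := by
  rw [← Finset.prod_fiberwise_of_maps_to (g := T.start) (t := T.Γ₂ᶜ)
    (fun b _ => Finset.mem_compl.2 (T.start_notMem b))]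
  refine Finset.prod_congr rfl fun a ha => ?_
  have : (Finset.univ.filter fun b => T.start b = a) = T.stringFrom a := by
    ext b
    simp [T.start_eq_iff (Finset.mem_compl.1 ha)]
  rw [this, AdmissibleTriple.weightFrom, ← Finset.prod_pow_eq_pow_sum]
  refine Finset.prod_congr rfl fun b hb => ?_
  rw [← T.apply_start hu b, (T.start_eq_iff (Finset.mem_compl.1 ha)).2 hb]

/-- The products of the compatible tuples are the powers with exponent `stringGcd`. -/
theorem exists_mem_compatible_prod_eq (T : AdmissibleTriple n) (hn : 0 < n) (g : G) :
    (∃ t ∈ compatible T G, ∏ i, t i = g) ↔ ∃ y, y ^ T.stringGcd = g := by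
  constructor
  · rintro ⟨t, ht, rfl⟩
    have h := exists_eq_ofRatios hn t
    rw [h, prod_ofRatios, prod_pow_eq_prod_weight T (mem_compatible.1 ht)]
    change _ ∈ (powMonoidHom T.stringGcd : G →* G).range
    refine mul_mem ?_ (prod_mem fun a ha => ?_)
    · obtain ⟨k, hk⟩ : T.stringGcd ∣ n := Nat.gcd_dvd_left _ _
      refine ⟨t ⟨n - 1, by omega⟩ ^ k, ?_⟩
      rw [powMonoidHom_apply, ← pow_mul, mul_comm k, ← hk]
    · obtain ⟨k, hk⟩ : T.stringGcd ∣ T.weightFrom a :=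
        (Nat.gcd_dvd_right _ _).trans (Finset.gcd_dvd ha)
      refine ⟨(t (lo a) / t (hi a)) ^ k, ?_⟩
      rw [powMonoidHom_apply, ← pow_mul, mul_comm k, ← hk]
  · rintro ⟨y, rfl⟩
    -- The exponents `k` with `y ^ k ∈ S` are closed under gcd by Bézout, so it suffices to realize
    -- `n` and each string weight.
    let S : Subgroup G := (compatible T G).map (∏ i, Pi.evalMonoidHom (fun _ : Fin n => G) i)
    have hS : ∀ g, g ∈ S ↔ ∃ t ∈ compatible T G, ∏ i, t i = g := by
      simp [S, Subgroup.mem_map, MonoidHom.finsetProd_apply]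
    have hgcd : ∀ a b : ℕ, y ^ a ∈ S → y ^ b ∈ S → y ^ Nat.gcd a b ∈ S := by
      intro a b ha hb
      rw [← zpow_natCast, Nat.gcd_eq_gcd_ab, zpow_add, zpow_mul, zpow_mul]
      exact mul_mem (zpow_mem (by simpa using ha) _)
        (zpow_mem (by simpa using hb) _)
    have hweight : ∀ s ⊆ T.Γ₂ᶜ, y ^ s.gcd T.weightFrom ∈ S := by
      intro s
      induction s using Finset.induction_on with
      | empty => simp
      | insert a s _ ih =>
        intro hs
        rw [Finset.gcd_insert]
        refine hgcd _ _ ((hS _).2 ?_) (ih fun b hb => hs (Finset.mem_insert_of_mem hb))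
        have ha := hs (Finset.mem_insert_self a s)
        -- Ratio `y` along the string of `a`, trivial ratios elsewhere, last entry `1`: the product
        -- is `y` to the weight of that string.
        let u : Fin (n - 1) → G := fun b => if T.start b = a then y else 1
        have hu : ∀ b : T.Γ₁, u (T.τ b).1 = u b.1 := by
          intro b
          simp only [u, T.start_tau]
        refine ⟨_, ofRatios_mem_compatible 1 hu, ?_⟩
        rw [prod_ofRatios, prod_pow_eq_prod_weight T hu, one_pow, one_mul,
          Finset.prod_eq_single_of_mem a ha]
        · simp [u, T.start_eq_iff (Finset.mem_compl.1 ha), AdmissibleTriple.stringFrom,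
            Relation.ReflTransGen.refl]
        · intro b hb hba
          have : T.start b = b := (T.start_eq_iff (Finset.mem_compl.1 hb)).2
            (by simp [AdmissibleTriple.stringFrom, Relation.ReflTransGen.refl])
          simp [u, this, hba]
    -- The exponent `n` comes from the constant tuple `y`.
    refine (hS _).1 (hgcd _ _ ((hS _).2 ⟨fun _ => y, fun a => by simp, by simp⟩)
      (hweight _ subset_rfl))

end Ratios

/-! ### The centralizer of `r` in `GL(n)`. -/

section Centralizer

variable {F : Type*} [Field F] {n : ℕ}

/-- The invertible diagonal matrices. -/
def diagGL : (Fin n → Fˣ) →* GL (Fin n) F :=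
  (Units.map (Matrix.diagonalRingHom (Fin n) F).toMonoidHom).comp
    MulEquiv.piUnits.symm.toMonoidHom

@[simp]
theorem coe_diagGL (t : Fin n → Fˣ) :
    (diagGL t : GL (Fin n) F).1 = Matrix.diagonal fun i => (t i : F) := rfl

@[simp]
theorem coe_inv_diagGL (t : Fin n → Fˣ) :
    ((diagGL t)⁻¹ : GL (Fin n) F).1 = Matrix.diagonal fun i => ((t i)⁻¹ : F) := by
  rw [← map_inv, coe_diagGL]
  simp

theorem isDiag_diagGL (t : Fin n → Fˣ) : (diagGL t : GL (Fin n) F).1.IsDiag :=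
  Matrix.isDiag_diagonal _

theorem det_diagGL (t : Fin n → Fˣ) :
    Matrix.GeneralLinearGroup.det (diagGL t : GL (Fin n) F) = ∏ i, t i := by
  ext
  simp [Matrix.det_diagonal]

theorem diagGL_injective : Function.Injective (diagGL : (Fin n → Fˣ) → GL (Fin n) F) := by
  intro s t h
  have h := congrArg Units.val h
  rw [coe_diagGL, coe_diagGL] at h
  exact funext fun i => Units.ext (congrFun (Matrix.diagonal_injective h) i)

theorem exists_eq_diagGL {X : GL (Fin n) F} (hX : X.1.IsDiag) : ∃ t, X = diagGL t := by
  have hd := X.det.ne_zero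
  rw [Matrix.GeneralLinearGroup.val_det_apply, ← hX.diagonal_diag, Matrix.det_diagonal,
    Finset.prod_ne_zero_iff] at hd
  refine ⟨fun i => Units.mk0 _ (hd i (Finset.mem_univ i)), Units.ext ?_⟩
  exact hX.diagonal_diag.symm

/-- A matrix `X` is triangular if conjugation by `X` maps elementary nilpotent matrices
to triangular matrices. The triangular shape is given by a well-order `rel`. -/
theorem apply_eq_zero_of_conj {ι : Type*} [Fintype ι] [DecidableEq ι] (rel : ι → ι → Prop)
    [IsWellOrder ι rel] (X : GL ι F)
    (h : ∀ k l i j, rel k l → rel i j → (X.1 * Matrix.single l k 1 * (X⁻¹).1 : Matrix ι ι F) i j = 0) :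
    ∀ i j, rel i j → X.1 i j = 0 := by
  -- The conjugate `M` squares to zero and is triangular, so each diagonal entry of `M` squares to
  -- zero.
  have hdiag : ∀ k l i, rel k l → (X.1 * Matrix.single l k 1 * (X⁻¹).1 : Matrix ι ι F) i i = 0 := by
    intro k l i hkl
    have hne : k ≠ l := fun e => irrefl_of rel l (e ▸ hkl)
    set M := X.1 * Matrix.single l k 1 * (X⁻¹).1 with hM
    have hsq : M * M = 0 := by
      have : M * M = X.1 * (Matrix.single l k 1 * ((X⁻¹).1 * X.1) * Matrix.single l k 1) *
          (X⁻¹).1 := by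
        simp only [hM, mul_assoc]
      rw [this, ← Units.val_mul, inv_mul_cancel, Units.val_one, mul_one,
        Matrix.single_mul_single_of_ne _ _ _ _ hne, mul_zero, zero_mul]
    have hii := congrFun (congrFun hsq i) i
    rw [Matrix.mul_apply, Finset.sum_eq_single i] at hii
    · simpa using hii
    · intro j _ hj
      rcases trichotomous_of rel i j with hr | hr | hr
      · rw [show M i j = 0 from h k l i j hkl hr, zero_mul]
      · exact absurd hr.symm hj
      · rw [show M j i = 0 from h k l j i hkl hr, mul_zero]
    · simp
  intro i j
  induction j using (IsWellFounded.wf (r := rel)).induction generalizing i with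
  | _ j ih =>
    intro hij
    set M := X.1 * Matrix.single j i 1 * (X⁻¹).1 with hM
    have hMX : M * X.1 = X.1 * Matrix.single j i 1 := by
      rw [hM, mul_assoc, ← Units.val_mul, inv_mul_cancel, Units.val_one, mul_one]
    -- The `(i, i)` entry of `M X = X E_{ji}` is `X i j`. In the expansion of `M X`, each term
    -- vanishes by the triangularity of `M`, by `hdiag`, or by induction.
    have hii := congrFun (congrFun hMX i) i
    rw [Matrix.mul_single_apply_same, mul_one, Matrix.mul_apply] at hii
    rw [← hii]
    refine Finset.sum_eq_zero fun l _ => ?_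
    rcases trichotomous_of rel i l with hr | rfl | hr
    · rw [hM, h i j i l hij hr, zero_mul]
    · rw [hM, hdiag i j i hij, zero_mul]
    · rw [ih i hij l hr, mul_zero]

/-- The operator `x ↦ ∑ tr(a x) b` given by a tensor `∑ a ⊗ b`. -/
def tensorOperator : Matrix (Fin n) (Fin n) F ⊗[F] Matrix (Fin n) (Fin n) F →ₗ[F]
    Matrix (Fin n) (Fin n) F →ₗ[F] Matrix (Fin n) (Fin n) F :=
  dualTensorHom F _ _ ∘ₗ
    LinearMap.rTensor _ ((LinearMap.mul F _).compr₂ (Matrix.traceLinearMap (Fin n) F F))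

theorem tensorOperator_tmul (a b x : Matrix (Fin n) (Fin n) F) :
    tensorOperator (a ⊗ₜ[F] b) x = (a * x).trace • b := by
  simp [tensorOperator, dualTensorHom_apply]

/-- The trace form is invariant under conjugation. -/
theorem tensorOperator_adTensor (X : GL (Fin n) F)
    (r : Matrix (Fin n) (Fin n) F ⊗[F] Matrix (Fin n) (Fin n) F)
    (x : Matrix (Fin n) (Fin n) F) :
    tensorOperator (adTensor X r) (X.1 * x * (X⁻¹).1) =
      X.1 * tensorOperator r x * (X⁻¹).1 := by
  induction r with
  | zero => simp
  | add r s hr hs => simp only [map_add, LinearMap.add_apply, hr, hs, mul_add, add_mul]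
  | tmul a b =>
    have h : X.1 * a * (X⁻¹).1 * (X.1 * x * (X⁻¹).1) = X.1 * (a * x) * (X⁻¹).1 := by
      calc _ = X.1 * a * ((X⁻¹).1 * X.1) * (x * (X⁻¹).1) := by simp only [mul_assoc]
        _ = _ := by
          rw [← Units.val_mul, inv_mul_cancel, Units.val_one, mul_one]
          simp only [mul_assoc]
    rw [adTensor, TensorProduct.map_tmul, LinearMap.mulLeftRight_apply,
      LinearMap.mulLeftRight_apply, tensorOperator_tmul, tensorOperator_tmul, h,
      Matrix.trace_mul_cycle, ← Units.val_mul, inv_mul_cancel, Units.val_one, one_mul,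
      Matrix.mul_smul, Matrix.smul_mul]

theorem tensorOperator_rootVector (c : Fin n → Fin n → F) (i j k l : Fin n)
    (x : Matrix (Fin n) (Fin n) F) :
    tensorOperator (rootVector c i j ⊗ₜ[F] rootVector c k l) x =
      Matrix.single k l (c i j * c k l * x j i) := by
  rw [tensorOperator_tmul, rootVector, rootVector, Matrix.trace_single_mul, Matrix.smul_single]
  congr 1
  simp
  ring

theorem tensorOperator_cartan_apply_of_ne (r₀ : cartan F n ⊗[F] cartan F n)
    (x : Matrix (Fin n) (Fin n) F) {i j : Fin n} (hij : i ≠ j) :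
    tensorOperator (TensorProduct.map (cartan F n).subtype (cartan F n).subtype r₀) x i j = 0 := by
  induction r₀ with
  | zero => simp
  | add r s hr hs => simp [hr, hs]
  | tmul a b => simp [tensorOperator_tmul, b.2.1 hij]

theorem tensorOperator_cartan_eq_zero (r₀ : cartan F n ⊗[F] cartan F n)
    {x : Matrix (Fin n) (Fin n) F} (hx : ∀ i, x i i = 0) :
    tensorOperator (TensorProduct.map (cartan F n).subtype (cartan F n).subtype r₀) x = 0 := by
  induction r₀ with
  | zero => simp
  | add r s hr hs => simp [hr, hs]
  | tmul a b =>
    have : (a.1 * x).trace = 0 := by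
      refine Finset.sum_eq_zero fun i _ => ?_
      rw [Matrix.diag_apply, ← a.2.1.diagonal_diag, Matrix.diagonal_mul, hx, mul_zero]
    simp [tensorOperator_tmul, this]

theorem IsRootSystemBasis.mul_eq_one {T : AdmissibleTriple n} {c : Fin n → Fin n → F}
    (hc : IsRootSystemBasis T c) {i j : Fin n} (hij : i ≠ j) : c i j * c j i = 1 := by
  simpa [rootVector, Matrix.trace_single_eq_same] using hc.1 i j hij

open Classical in
/-- The entries of the operator given by a Belavin–Drinfeld `r`-matrix. -/
theorem IsBDMatrix.exists_tensorOperator_apply {T : AdmissibleTriple n}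
    {r : Matrix (Fin n) (Fin n) F ⊗[F] Matrix (Fin n) (Fin n) F} (hr : IsBDMatrix T r) :
    ∃ w : Fin n × Fin n → Fin n × Fin n → F,
      (∀ p q, Relation.TransGen T.rootStep p q → w p q ≠ 0) ∧
      (∀ x k l, k < l → tensorOperator r x k l = x k l +
        ∑ p with Relation.TransGen T.rootStep p (k, l), w p (k, l) * x p.1 p.2) ∧
      (∀ x k l, k < l → tensorOperator r x l k =
        -∑ q with Relation.TransGen T.rootStep (k, l) q, w (k, l) q * x q.2 q.1) ∧
      (∀ x : Matrix (Fin n) (Fin n) F, (∀ i, x i i = 0) → ∀ i, tensorOperator r x i i = 0) := by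
  obtain ⟨r₀, c, -, hc, rfl⟩ := hr
  have hlt := @AdmissibleTriple.lt_of_transGen_rootStep n T
  -- The standard part of `r` acts as the projection to strictly upper entries.
  have key : ∀ x i j, tensorOperator (∑ p : Fin n × Fin n with p.1 < p.2,
      rootVector c p.2 p.1 ⊗ₜ[F] rootVector c p.1 p.2) x i j = if i < j then x i j else 0 := by
    intro x i j
    simp only [map_sum, LinearMap.sum_apply, tensorOperator_rootVector, Matrix.sum_apply]
    split_ifs with h
    · rw [Finset.sum_eq_single_of_mem (i, j) (by simpa using h)]
      · simp [hc.mul_eq_one h.ne']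
      · intro p _ hp
        refine Matrix.single_apply_of_ne _ _ _ _ _ fun e => hp (Prod.ext e.1 e.2)
    · refine Finset.sum_eq_zero fun p hp => Matrix.single_apply_of_ne _ _ _ _ _ fun e => h ?_
      simpa [e.1, e.2] using hp
  have key' : ∀ x i j, tensorOperator (∑ pq : (Fin n × Fin n) × (Fin n × Fin n) with
      Relation.TransGen T.rootStep pq.1 pq.2,
        wedge (rootVector c pq.1.2 pq.1.1) (rootVector c pq.2.1 pq.2.2)) x i j =
      (∑ p with Relation.TransGen T.rootStep p (i, j), c p.2 p.1 * c i j * x p.1 p.2) -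
      ∑ q with Relation.TransGen T.rootStep (j, i) q, c i j * c q.1 q.2 * x q.2 q.1 := by
    intro x i j
    simp only [map_sum, LinearMap.sum_apply, wedge, map_sub, LinearMap.sub_apply,
      tensorOperator_rootVector, Matrix.sum_apply, Matrix.sub_apply, Finset.sum_sub_distrib]
    rw [Finset.sum_filter, Finset.sum_filter, Finset.sum_filter, Finset.sum_filter]
    congr 1
    · rw [Fintype.sum_prod_type]
      refine Finset.sum_congr rfl fun p _ => ?_
      rw [Finset.sum_eq_single_of_mem (i, j) (Finset.mem_univ _)]
      · simp
      · intro q _ hq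
        rw [Matrix.single_apply_of_ne _ _ _ _ _ fun e => hq (Prod.ext e.1 e.2), ite_self]
    · rw [Fintype.sum_prod_type_right]
      refine Finset.sum_congr rfl fun q _ => ?_
      rw [Finset.sum_eq_single_of_mem (j, i) (Finset.mem_univ _)]
      · simp [mul_comm]
      · intro p _ hp
        rw [Matrix.single_apply_of_ne _ _ _ _ _ fun e => hp (Prod.ext e.2 e.1), ite_self]
  refine ⟨fun p q => c p.2 p.1 * c q.1 q.2, ?_, ?_, ?_, ?_⟩
  · intro p q h
    have h1 := hc.mul_eq_one (hlt h).1.ne'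
    have h2 := hc.mul_eq_one (hlt h).2.ne
    exact mul_ne_zero (left_ne_zero_of_mul_eq_one h1) (left_ne_zero_of_mul_eq_one h2)
  · intro x k l hkl
    rw [map_add, map_add, LinearMap.add_apply, LinearMap.add_apply, Matrix.add_apply,
      Matrix.add_apply, key, key', tensorOperator_cartan_apply_of_ne _ _ hkl.ne, if_pos hkl,
      Finset.filter_false_of_mem (p := fun q => Relation.TransGen T.rootStep (l, k) q)
        fun q _ h => hkl.not_gt (hlt h).1]
    simp
  · intro x k l hkl
    rw [map_add, map_add, LinearMap.add_apply, LinearMap.add_apply, Matrix.add_apply,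
      Matrix.add_apply, key, key', tensorOperator_cartan_apply_of_ne _ _ hkl.ne',
      if_neg hkl.not_gt,
      Finset.filter_false_of_mem (p := fun p => Relation.TransGen T.rootStep p (l, k))
        fun q _ h => hkl.not_gt (hlt h).2]
    simp
  · intro x hx i
    rw [map_add, map_add, LinearMap.add_apply, LinearMap.add_apply, Matrix.add_apply,
      Matrix.add_apply, key, key', tensorOperator_cartan_eq_zero _ hx, if_neg (lt_irrefl i),
      Finset.filter_false_of_mem (p := fun p => Relation.TransGen T.rootStep p (i, i))
        fun q _ h => lt_irrefl _ (hlt h).2,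
      Finset.filter_false_of_mem (p := fun q => Relation.TransGen T.rootStep (i, i) q)
        fun q _ h => lt_irrefl _ (hlt h).1]
    simp

theorem tensorOperator_conj_of_mem_centralizerGL
    {r : Matrix (Fin n) (Fin n) F ⊗[F] Matrix (Fin n) (Fin n) F} {X : GL (Fin n) F}
    (hX : X ∈ centralizerGL r) (x : Matrix (Fin n) (Fin n) F) :
    tensorOperator r (X.1 * x * (X⁻¹).1) = X.1 * tensorOperator r x * (X⁻¹).1 := by
  have h := tensorOperator_adTensor X r x
  rwa [show adTensor X r = r from hX] at h

/-- Extends a vanishing statement about `φ x` from elementary matrices to linear combinations. -/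
theorem linearMap_apply_eq_zero_of_single (φ : Matrix (Fin n) (Fin n) F →ₗ[F] F)
    (x : Matrix (Fin n) (Fin n) F)
    (h : ∀ i j, x i j ≠ 0 → φ (Matrix.single i j 1) = 0) : φ x = 0 := by
  rw [Matrix.matrix_eq_sum_single x, map_sum]
  refine Finset.sum_eq_zero fun i _ => ?_
  rw [map_sum]
  refine Finset.sum_eq_zero fun j _ => ?_
  by_cases hx : x i j = 0
  · simp [hx]
  · rw [← mul_one (x i j), ← smul_eq_mul, ← Matrix.smul_single, map_smul, h i j hx, smul_zero]

/-- The centralizer of a Belavin–Drinfeld `r`-matrix consists of diagonal matrices. -/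
theorem IsBDMatrix.isDiag_of_mem_centralizerGL {T : AdmissibleTriple n}
    {r : Matrix (Fin n) (Fin n) F ⊗[F] Matrix (Fin n) (Fin n) F} (hr : IsBDMatrix T r)
    {X : GL (Fin n) F} (hX : X ∈ centralizerGL r) : X.1.IsDiag := by
  classical
  obtain ⟨w, -, hup, hlow, hdiag⟩ := hr.exists_tensorOperator_apply
  have hconj := tensorOperator_conj_of_mem_centralizerGL hX
  let entry (i j : Fin n) : Matrix (Fin n) (Fin n) F →ₗ[F] F :=
    Matrix.entryLinearMap F F i j ∘ₗ LinearMap.mulLeftRight F (X.1, (X⁻¹).1)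
  have hentry : ∀ i j x, entry i j x = (X.1 * x * (X⁻¹).1) i j := fun i j x => by
    simp [entry, LinearMap.mulLeftRight_apply]
  -- `R` sends `E_{-p}` to a combination of `E_{-q}` with `p` an iterated `τ`-image of `q`. By
  -- induction the conjugate of `R(E_{-p})` has no strictly upper entries.
  have hL : ∀ p : Fin n × Fin n, p.1 < p.2 → ∀ i j, i < j →
      (X.1 * Matrix.single p.2 p.1 1 * (X⁻¹).1 : Matrix (Fin n) (Fin n) F) i j = 0 := by
    intro p
    induction p using T.wellFounded_transGen_rootStep.induction with
    | _ p ih =>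
      intro hp
      have hR : ∀ i j, i < j →
          (X.1 * tensorOperator r (Matrix.single p.2 p.1 1) * (X⁻¹).1) i j = 0 := by
        intro i j hij
        rw [← hentry]
        refine linearMap_apply_eq_zero_of_single _ _ fun l k hlk => ?_
        rcases lt_trichotomy k l with hkl | rfl | hkl
        · rw [hentry]
          refine ih (k, l) ?_ hkl i j hij
          rw [hlow _ _ _ hkl, neg_ne_zero] at hlk
          obtain ⟨q, hq, hq'⟩ := Finset.exists_ne_zero_of_sum_ne_zero hlk
          have hqp : q = p := by
            by_contra hne
            refine hq' ?_
            rw [Matrix.single_apply_of_ne _ _ _ _ _ fun e => hne (Prod.ext e.2.symm e.1.symm),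
              mul_zero]
          simpa [hqp, flip] using hq
        · refine absurd (hdiag _ (fun i => ?_) k) hlk
          exact Matrix.single_apply_of_ne _ _ _ _ _ fun e => hp.ne (e.2.trans e.1.symm)
        · refine absurd ?_ hlk
          rw [hup _ _ _ hkl, Matrix.single_apply_of_ne _ _ _ _ _
            fun e => (hkl.trans (e.2.symm.trans_lt (hp.trans_eq e.1))).false, zero_add]
          refine Finset.sum_eq_zero fun q hq => ?_
          have hq := (AdmissibleTriple.lt_of_transGen_rootStep (by simpa using hq)).1
          rw [Matrix.single_apply_of_ne _ _ _ _ _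
            fun e => (hq.trans (e.2.symm.trans_lt (hp.trans_eq e.1))).false, mul_zero]
      intro i j
      -- `R` is unipotent on strictly upper entries, so the vanishing of those of `R(X E_{-p} X⁻¹)`
      -- passes to `X E_{-p} X⁻¹`.
      have key : ∀ q : Fin n × Fin n, q.1 < q.2 →
          (X.1 * Matrix.single p.2 p.1 1 * (X⁻¹).1 : Matrix (Fin n) (Fin n) F) q.1 q.2 = 0 := by
        intro q
        induction q using T.wellFounded_transGen_rootStep.induction with
        | _ q ihq =>
          intro hq
          have h := hR q.1 q.2 hq
          rw [← hconj, hup _ _ _ hq, Finset.sum_eq_zero, add_zero] at h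
          · exact h
          · intro s hs
            have hs : Relation.TransGen T.rootStep s q := by simpa using hs
            rw [ihq s hs (AdmissibleTriple.lt_of_transGen_rootStep hs).1, mul_zero]
      exact key (i, j)
  -- The mirror argument uses `R - 1`, which sends `E_p` to root vectors further along `τ` and is
  -- invertible on strictly lower entries.
  have hU : ∀ p : Fin n × Fin n, p.1 < p.2 → ∀ i j, i < j →
      (X.1 * Matrix.single p.1 p.2 1 * (X⁻¹).1 : Matrix (Fin n) (Fin n) F) j i = 0 := by
    intro p
    induction p using T.wellFounded_flip_transGen_rootStep.induction with
    | _ p ih =>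
      intro hp
      have hR : ∀ i j, i < j →
          (X.1 * (tensorOperator r (Matrix.single p.1 p.2 1) - Matrix.single p.1 p.2 1) *
            (X⁻¹).1 : Matrix (Fin n) (Fin n) F) j i = 0 := by
        intro i j hij
        rw [← hentry]
        refine linearMap_apply_eq_zero_of_single _ _ fun k l hkl' => ?_
        rw [Matrix.sub_apply] at hkl'
        rcases lt_trichotomy k l with hkl | rfl | hkl
        · rw [hentry]
          refine ih (k, l) ?_ hkl i j hij
          rw [hup _ _ _ hkl, add_sub_cancel_left] at hkl'
          obtain ⟨q, hq, hq'⟩ := Finset.exists_ne_zero_of_sum_ne_zero hkl'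
          have hqp : q = p := by
            by_contra hne
            refine hq' ?_
            rw [Matrix.single_apply_of_ne _ _ _ _ _ fun e => hne (Prod.ext e.1.symm e.2.symm),
              mul_zero]
          simpa [hqp, flip] using hq
        · have h0 : ∀ i, (Matrix.single p.1 p.2 (1 : F)) i i = 0 := fun i =>
            Matrix.single_apply_of_ne _ _ _ _ _ fun e => hp.ne (e.1.trans e.2.symm)
          rw [hdiag _ h0, h0, sub_zero] at hkl'
          exact absurd rfl hkl'
        · refine absurd ?_ hkl'
          rw [hlow _ _ _ hkl, Matrix.single_apply_of_ne _ _ _ _ _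
            fun e => (hkl.trans (e.1.symm.trans_lt (hp.trans_eq e.2))).false, sub_zero, neg_eq_zero]
          refine Finset.sum_eq_zero fun q hq => ?_
          have hq := (AdmissibleTriple.lt_of_transGen_rootStep (by simpa using hq)).2
          rw [Matrix.single_apply_of_ne _ _ _ _ _
            fun e => (hq.trans (e.1.symm.trans_lt (hp.trans_eq e.2))).false, mul_zero]
      intro i j
      have key : ∀ q : Fin n × Fin n, q.1 < q.2 →
          (X.1 * Matrix.single p.1 p.2 1 * (X⁻¹).1 : Matrix (Fin n) (Fin n) F) q.2 q.1 = 0 := by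
        intro q
        induction q using T.wellFounded_flip_transGen_rootStep.induction with
        | _ q ihq =>
          intro hq
          have h := hR q.1 q.2 hq
          rw [mul_sub, sub_mul, Matrix.sub_apply, ← hconj, hlow _ _ _ hq, Finset.sum_eq_zero,
            neg_zero, zero_sub, neg_eq_zero] at h
          · exact h
          · intro s hs
            have hs : Relation.TransGen T.rootStep q s := by simpa using hs
            rw [ihq s hs (AdmissibleTriple.lt_of_transGen_rootStep hs).2, mul_zero]
      exact key (i, j)
  intro i j hij
  rcases lt_or_gt_of_ne hij with h | h
  · exact apply_eq_zero_of_conj (· < ·) X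
      (fun k l i j hkl hij => hL (k, l) hkl i j hij) i j h
  · exact apply_eq_zero_of_conj (· > ·) X
      (fun k l i j hkl hij => hU (l, k) hkl j i hij) i j h

theorem diagGL_conj_apply (t : Fin n → Fˣ) (x : Matrix (Fin n) (Fin n) F) (i j : Fin n) :
    ((diagGL t).1 * x * ((diagGL t)⁻¹).1) i j = (t i / t j : Fˣ) * x i j := by
  rw [coe_diagGL, coe_inv_diagGL, Matrix.mul_diagonal, Matrix.diagonal_mul, div_eq_mul_inv,
    Units.val_mul, Units.val_inv_eq_inv_val]
  ring

/-- Evaluation at `t` is a character `χ` of `ℤⁿ`, so the relations for simple roots extend to their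
nonnegative combinations. -/
theorem rootStep_ratio {G : Type*} [CommGroup G] {T : AdmissibleTriple n} {t : Fin n → G}
    (ht : t ∈ compatible T G) {p q : Fin n × Fin n} (h : T.rootStep p q) :
    t q.1 / t q.2 = t p.1 / t p.2 := by
  obtain ⟨-, -, c, hp, hq⟩ := h
  let χ : Multiplicative (Fin n → ℤ) →* G :=
    { toFun := fun v => ∏ i, t i ^ (v.toAdd i)
      map_one' := by simp
      map_mul' := by simp [zpow_add, Finset.prod_mul_distrib] }
  have hχ : ∀ i j, χ (.ofAdd (root i j)) = t i / t j := by
    intro i j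
    have h : ∀ i, ∏ k, t k ^ (Pi.single i (1 : ℤ) : Fin n → ℤ) k = t i := by
      intro i
      rw [Finset.prod_eq_single i] <;> simp +contextual
    simp only [χ, root, MonoidHom.coe_mk, OneHom.coe_mk, toAdd_ofAdd, Pi.sub_apply, zpow_sub,
      Finset.prod_mul_distrib, Finset.prod_inv_distrib, h, div_eq_mul_inv]
  rw [← hχ, ← hχ, hp, hq, ofAdd_sum, ofAdd_sum, map_prod, map_prod]
  refine Finset.prod_congr rfl fun a _ => ?_
  rw [ofAdd_nsmul, ofAdd_nsmul, map_pow, map_pow, simpleRoot_eq, simpleRoot_eq, hχ, hχ, ht a]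

theorem transGen_ratio {G : Type*} [CommGroup G] {T : AdmissibleTriple n} {t : Fin n → G}
    (ht : t ∈ compatible T G) {p q : Fin n × Fin n} (h : Relation.TransGen T.rootStep p q) :
    t q.1 / t q.2 = t p.1 / t p.2 := by
  induction h with
  | single h => exact rootStep_ratio ht h
  | tail _ h ih => rw [rootStep_ratio ht h, ih]

theorem diagGL_conj_rootVector (t : Fin n → Fˣ) (c : Fin n → Fin n → F) (i j : Fin n) :
    (diagGL t).1 * rootVector c i j * ((diagGL t)⁻¹).1 =
      ((t i / t j : Fˣ) : F) • rootVector c i j := by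
  ext k l
  rw [diagGL_conj_apply, Matrix.smul_apply, smul_eq_mul, rootVector, Matrix.single_apply]
  split_ifs with h
  · rw [h.1, h.2]
  · simp

theorem diagGL_conj_cartan (t : Fin n → Fˣ) (a : cartan F n) :
    (diagGL t).1 * a.1 * ((diagGL t)⁻¹).1 = a.1 := by
  ext i j
  rw [diagGL_conj_apply]
  by_cases h : i = j
  · simp [h]
  · rw [a.2.1 h, mul_zero]

/-- Each summand is fixed: the Cartan part commutes with diagonal matrices, `e_{-α} ⊗ e_α` has
weight zero, and the weight of `e_{-α} ∧ e_{τ^k(α)}` is trivial on compatible tuples. -/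
theorem IsBDMatrix.diagGL_mem_centralizerGL {T : AdmissibleTriple n}
    {r : Matrix (Fin n) (Fin n) F ⊗[F] Matrix (Fin n) (Fin n) F} (hr : IsBDMatrix T r)
    {t : Fin n → Fˣ} (ht : t ∈ compatible T Fˣ) : diagGL t ∈ centralizerGL r := by
  classical
  obtain ⟨r₀, c, -, -, rfl⟩ := hr
  change adTensor (diagGL t) _ = _
  have hroot : ∀ i j k l, adTensor (diagGL t) (rootVector c i j ⊗ₜ[F] rootVector c k l) =
      ((t i / t j * (t k / t l) : Fˣ) : F) • (rootVector c i j ⊗ₜ[F] rootVector c k l) := by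
    intro i j k l
    rw [adTensor, TensorProduct.map_tmul, LinearMap.mulLeftRight_apply,
      LinearMap.mulLeftRight_apply, diagGL_conj_rootVector, diagGL_conj_rootVector,
      TensorProduct.smul_tmul_smul, Units.val_mul]
  rw [map_add, map_add, map_sum, map_sum]
  congr 1
  · congr 1
    · induction r₀ with
      | zero => simp
      | add r s hr hs => rw [map_add, map_add, hr, hs]
      | tmul a b =>
        rw [adTensor, TensorProduct.map_tmul, TensorProduct.map_tmul,
          LinearMap.mulLeftRight_apply, LinearMap.mulLeftRight_apply]
        exact congrArg₂ _ (diagGL_conj_cartan t a) (diagGL_conj_cartan t b)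
    · refine Finset.sum_congr rfl fun p _ => ?_
      rw [hroot]
      simp
  · refine Finset.sum_congr rfl fun pq h => ?_
    have h := transGen_ratio ht (Finset.mem_filter.1 h).2
    have h1 : t pq.1.2 / t pq.1.1 * (t pq.2.1 / t pq.2.2) = 1 := by
      rw [h]; simp
    rw [wedge, map_sub, hroot, hroot, mul_comm (t pq.2.1 / t pq.2.2), h1, Units.val_one,
      one_smul, one_smul]

/-- For `α ∈ Γ₁`, the coefficient of `R(e_α)` at the root `τ(α)` is nonzero. Commuting with
conjugation by `diag(t)` then equates the values of `α` and `τ(α)` at `t`. -/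
theorem IsBDMatrix.mem_compatible_of_diagGL_mem {T : AdmissibleTriple n}
    {r : Matrix (Fin n) (Fin n) F ⊗[F] Matrix (Fin n) (Fin n) F} (hr : IsBDMatrix T r)
    {t : Fin n → Fˣ} (ht : diagGL t ∈ centralizerGL r) : t ∈ compatible T Fˣ := by
  classical
  intro a
  obtain ⟨w, hw, hup, -, -⟩ := hr.exists_tensorOperator_apply
  have hs := Relation.TransGen.single (T.rootStep_simple a)
  set p : Fin n × Fin n := (lo a.1, hi a.1)
  set q : Fin n × Fin n := (lo (T.τ a).1, hi (T.τ a).1)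
  have hpq : p ≠ q := fun h => by
    have := AdmissibleTriple.rootHeight_lt_of_transGen hs
    rw [h] at this
    exact this.false
  have hval : ∀ z : F, tensorOperator r (Matrix.single p.1 p.2 z) q.1 q.2 = w p q * z := by
    intro z
    rw [hup _ _ _ (lo_lt_hi _), Matrix.single_apply_of_ne _ _ _ _ _
      fun e => hpq (Prod.ext e.1 e.2), zero_add, Finset.sum_eq_single_of_mem p (by simpa using hs)]
    · rw [Matrix.single_apply_same]
    · intro s _ hsp
      rw [Matrix.single_apply_of_ne _ _ _ _ _ fun e => hsp (Prod.ext e.1.symm e.2.symm), mul_zero]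
  have h := congrFun (congrFun (tensorOperator_conj_of_mem_centralizerGL ht
    (Matrix.single p.1 p.2 1)) q.1) q.2
  have hconj : (diagGL t).1 * Matrix.single p.1 p.2 1 * ((diagGL t)⁻¹).1 =
      Matrix.single p.1 p.2 ((t p.1 / t p.2 : Fˣ) : F) := by
    simpa [rootVector, Matrix.smul_single] using diagGL_conj_rootVector t (fun _ _ => 1) p.1 p.2
  rw [diagGL_conj_apply, hconj, hval, hval, mul_one, mul_comm] at h
  exact Units.ext (mul_right_cancel₀ (hw p q hs) h).symm

/-- The centralizer of a Belavin–Drinfeld `r`-matrix in `GL(n)`. -/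
theorem IsBDMatrix.mem_centralizerGL_iff {T : AdmissibleTriple n}
    {r : Matrix (Fin n) (Fin n) F ⊗[F] Matrix (Fin n) (Fin n) F} (hr : IsBDMatrix T r)
    {X : GL (Fin n) F} : X ∈ centralizerGL r ↔ ∃ t ∈ compatible T Fˣ, diagGL t = X := by
  constructor
  · intro hX
    obtain ⟨t, rfl⟩ := exists_eq_diagGL (hr.isDiag_of_mem_centralizerGL hX)
    exact ⟨t, hr.mem_compatible_of_diagGL_mem hX, rfl⟩
  · rintro ⟨t, ht, rfl⟩
    exact hr.diagGL_mem_centralizerGL ht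

end Centralizer

/-! ### `N`-th power classes of Laurent series. -/

section LaurentSeries

/-- A power series with nonzero constant coefficient over an algebraically closed field of
characteristic zero has `N`-th roots. -/
theorem exists_pow_eq_powerSeries {k : Type*} [Field k] [IsAlgClosed k] [CharZero k] {N : ℕ}
    (hN : 0 < N) (p : PowerSeries k) (hp : PowerSeries.constantCoeff p ≠ 0) :
    ∃ q, q ^ N = p := by
  obtain ⟨c, hc⟩ := IsAlgClosed.exists_pow_nat_eq (PowerSeries.constantCoeff p) hN
  have hc0 : c ≠ 0 := by
    rintro rfl
    exact hp (by rw [← hc, zero_pow hN.ne'])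
  have hN0 : (N : k) ≠ 0 := by exact_mod_cast hN.ne'
  -- Hensel lifting along `(X)` starts from a root `c` of the constant term, where the derivative `N
  -- * c ^ (N - 1)` is a unit.
  obtain ⟨q, hq, _⟩ := HenselianRing.is_henselian (I := Ideal.span {(PowerSeries.X : PowerSeries k)})
    (Polynomial.X ^ N - Polynomial.C p) (Polynomial.monic_X_pow_sub_C p hN.ne')
    (PowerSeries.C c) (by
      rw [Ideal.mem_span_singleton, PowerSeries.X_dvd_iff]
      simp [hc]) (by
      refine IsUnit.map _ (PowerSeries.isUnit_iff_constantCoeff.2 ?_)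
      simp [Polynomial.derivative_X_pow, hN0, hc0])
  exact ⟨q, by simpa [Polynomial.IsRoot, sub_eq_zero] using hq⟩

/-- The order of a nonzero Laurent series modulo `N`. -/
def orderMod (k : Type*) [Field k] (N : ℕ) : (LaurentSeries k)ˣ →* Multiplicative (ZMod N) where
  toFun x := .ofAdd (x.1.order : ZMod N)
  map_one' := by simp
  map_mul' x y := by
    rw [Units.val_mul, HahnSeries.order_mul x.ne_zero y.ne_zero]
    simp

/-- A nonzero series is a monomial with exponent its order, times a power series with nonzero
constant term. The second factor is always an `N`-th power. -/
theorem ker_orderMod (k : Type*) [Field k] [IsAlgClosed k] [CharZero k] {N : ℕ} (hN : 0 < N) :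
    (orderMod k N).ker = powerSubgroup (LaurentSeries k) N := by
  ext x
  rw [MonoidHom.mem_ker, powerSubgroup, MonoidHom.mem_range]
  constructor
  · intro h
    have h : ((x.1.order : ℤ) : ZMod N) = 0 := h
    obtain ⟨m, hm⟩ := (ZMod.intCast_zmod_eq_zero_iff_dvd _ _).1 h
    obtain ⟨q, hq⟩ := exists_pow_eq_powerSeries hN (LaurentSeries.powerSeriesPart x.1) (by
      rw [← PowerSeries.coeff_zero_eq_constantCoeff_apply, LaurentSeries.powerSeriesPart_coeff]
      simp)
    have hx : (HahnSeries.single m 1 * HahnSeries.ofPowerSeries ℤ k q) ^ N = x.1 := by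
      rw [mul_pow, ← map_pow (HahnSeries.ofPowerSeries ℤ k), hq, HahnSeries.single_pow, one_pow]
      conv_rhs => rw [← LaurentSeries.single_order_mul_powerSeriesPart x.1, hm]
      simp
    refine ⟨Units.mk0 _ fun h0 => x.ne_zero ?_, Units.ext hx⟩
    rw [← hx, h0, zero_pow hN.ne']
  · rintro ⟨y, rfl⟩
    rw [powMonoidHom_apply, map_pow]
    change Multiplicative.ofAdd (N • (y.1.order : ZMod N)) = 1
    simp

theorem card_units_laurentSeries_quotient (k : Type*) [Field k] [IsAlgClosed k] [CharZero k]
    {N : ℕ} (hN : 0 < N) :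
    Nat.card ((LaurentSeries k)ˣ ⧸ powerSubgroup (LaurentSeries k) N) = N := by
  have hs : Function.Surjective (orderMod k N) := by
    intro z
    obtain ⟨m, hm⟩ := ZMod.intCast_surjective z.toAdd
    refine ⟨Units.mk0 (HahnSeries.single m 1) (by simp), ?_⟩
    change Multiplicative.ofAdd (((HahnSeries.single m (1 : k)).order : ℤ) : ZMod N) = z
    rw [HahnSeries.order_single one_ne_zero, hm]
    rfl
  rw [← ker_orderMod k hN,
    Nat.card_congr (QuotientGroup.quotientKerEquivOfSurjective _ hs).toEquiv,
    Nat.card_congr Multiplicative.toAdd, Nat.card_zmod]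

end LaurentSeries

/-! ### Diagonal representatives of cocycles, their equivalence, and the count of classes. -/

section Cocycles

/-- The entrywise image of a tuple of units under a ring homomorphism. -/
def mapTuple {n : ℕ} {A B : Type*} [Field A] [Field B] (f : A →+* B) :
    (Fin n → Aˣ) →* (Fin n → Bˣ) :=
  MonoidHom.compLeft (Units.map f.toMonoidHom) (Fin n)

section Tuples

variable {n : ℕ} {A B : Type*} [Field A] [Field B]

theorem mapTuple_apply (f : A →+* B) (t : Fin n → Aˣ) (i : Fin n) :
    mapTuple f t i = Units.map f.toMonoidHom (t i) := rfl

theorem map_diagGL (f : A →+* B) (t : Fin n → Aˣ) :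
    Matrix.GeneralLinearGroup.map f (diagGL t) = diagGL (mapTuple f t) := by
  ext i j
  change f (Matrix.diagonal _ i j) = Matrix.diagonal _ i j
  simp only [Matrix.diagonal_apply, apply_ite f, map_zero]
  rfl

theorem prod_mapTuple (f : A →+* B) (t : Fin n → Aˣ) :
    ∏ i, mapTuple f t i = Units.map f.toMonoidHom (∏ i, t i) := by
  simp only [mapTuple_apply, map_prod]

theorem mapTuple_mem_compatible_iff {T : AdmissibleTriple n} (f : A →+* B) {t : Fin n → Aˣ} :
    mapTuple f t ∈ compatible T Bˣ ↔ t ∈ compatible T Aˣ := by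
  have hf : Function.Injective (Units.map f.toMonoidHom) := Units.map_injective f.injective
  simp only [mem_compatible, mapTuple_apply, ← map_div, hf.eq_iff]

theorem mapTuple_ofRatios (f : A →+* B) (v : Aˣ) (u : Fin (n - 1) → Aˣ) :
    mapTuple f (ofRatios v u) =
      ofRatios (Units.map f.toMonoidHom v) fun a => Units.map f.toMonoidHom (u a) := by
  ext i
  simp [mapTuple_apply, ofRatios]

theorem toGL_map (f : A →+* B) (X : Matrix.SpecialLinearGroup (Fin n) A) :
    Matrix.SpecialLinearGroup.toGL (Matrix.SpecialLinearGroup.map f X) =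
      Matrix.GeneralLinearGroup.map f (Matrix.SpecialLinearGroup.toGL X) := by
  ext i j
  rfl

theorem toGL_injective :
    Function.Injective (Matrix.SpecialLinearGroup.toGL :
      Matrix.SpecialLinearGroup (Fin n) A → GL (Fin n) A) := by
  intro X Y h
  exact Subtype.ext (congrArg Units.val h)

theorem exists_toGL_eq {X : GL (Fin n) A} (hX : Matrix.GeneralLinearGroup.det X = 1) :
    ∃ Y, Matrix.SpecialLinearGroup.toGL Y = X :=
  ⟨⟨X.1, congrArg Units.val hX⟩, Units.ext rfl⟩

theorem det_toGL (X : Matrix.SpecialLinearGroup (Fin n) A) :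
    Matrix.GeneralLinearGroup.det (Matrix.SpecialLinearGroup.toGL X) = 1 :=
  Units.ext X.2

theorem exists_diagGL_of_map {f : A →+* B} {X : GL (Fin n) A} {t : Fin n → Bˣ}
    (h : Matrix.GeneralLinearGroup.map f X = diagGL t) : ∃ s, X = diagGL s ∧ mapTuple f s = t := by
  obtain ⟨s, rfl⟩ := exists_eq_diagGL (X := X) fun i j hij => f.injective <| by
    have h := Matrix.GeneralLinearGroup.ext_iff _ _ |>.1 h i j
    rw [map_zero]
    exact h.trans (Matrix.diagonal_apply_ne _ hij)
  exact ⟨s, rfl, diagGL_injective (by rw [← map_diagGL, h])⟩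

end Tuples

variable {F L : Type*} [Field F] [Field L] [Algebra F L] {n : ℕ} {T : AdmissibleTriple n}
  {r : Matrix (Fin n) (Fin n) L ⊗[L] Matrix (Fin n) (Fin n) L}

theorem mem_cocycles_iff {X : Matrix.SpecialLinearGroup (Fin n) L} :
    X ∈ cocycles F r ↔ ∀ σ : L ≃ₐ[F] L,
      (Matrix.SpecialLinearGroup.toGL X)⁻¹ * Matrix.GeneralLinearGroup.map (σ : L →+* L)
        (Matrix.SpecialLinearGroup.toGL X) ∈ centralizerGL r := by
  simp only [cocycles, Set.mem_ofPred_eq, centralizerSL, Subgroup.mem_comap, map_mul, map_inv,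
    toGL_map]

theorem map_algEquiv_map_algebraMap (σ : L ≃ₐ[F] L) (X : GL (Fin n) F) :
    Matrix.GeneralLinearGroup.map (σ : L →+* L)
      (Matrix.GeneralLinearGroup.map (algebraMap F L) X) =
      Matrix.GeneralLinearGroup.map (algebraMap F L) X := by
  ext i j
  exact σ.commutes _

theorem mapTuple_algEquiv_algebraMap (σ : L ≃ₐ[F] L) (s : Fin n → Fˣ) :
    mapTuple (σ : L →+* L) (mapTuple (algebraMap F L) s) = mapTuple (algebraMap F L) s := by
  ext i
  exact σ.commutes _

/-- The rational part cancels in `D⁻¹ σ(D)`, leaving `t⁻¹ σ(t)`, and `σ` preserves compatibility. -/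
theorem mem_cocycles_of_eq_diagGL (hr : IsBDMatrix T r) {D : Matrix.SpecialLinearGroup (Fin n) L}
    {s : Fin n → Fˣ} {t : Fin n → Lˣ} (ht : t ∈ compatible T Lˣ)
    (hD : Matrix.SpecialLinearGroup.toGL D = diagGL (mapTuple (algebraMap F L) s * t)) :
    D ∈ cocycles F r := by
  rw [mem_cocycles_iff]
  intro σ
  rw [hD, map_diagGL, ← map_inv, ← map_mul, map_mul (mapTuple _), mapTuple_algEquiv_algebraMap,
    hr.mem_centralizerGL_iff]
  refine ⟨_, ?_, rfl⟩
  rw [mul_inv, mul_mul_mul_comm, inv_mul_cancel, one_mul]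
  exact mul_mem (inv_mem ht) ((mapTuple_mem_compatible_iff _).2 ht)

theorem IsBDMatrix.isFactorization_iff (hr : IsBDMatrix T r)
    {D : Matrix.SpecialLinearGroup (Fin n) L} {A₁ : GL (Fin n) F} {A₂ : GL (Fin n) L} :
    IsFactorization r D A₁ A₂ ↔ ∃ s, ∃ t ∈ compatible T Lˣ, A₁ = diagGL s ∧ A₂ = diagGL t ∧
      Matrix.SpecialLinearGroup.toGL D = diagGL (mapTuple (algebraMap F L) s * t) := by
  constructor
  · rintro ⟨h₁, h₂, h⟩
    obtain ⟨s, rfl⟩ := exists_eq_diagGL h₁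
    obtain ⟨t, ht, rfl⟩ := hr.mem_centralizerGL_iff.1 h₂
    exact ⟨s, t, ht, rfl, rfl, by rw [h, map_diagGL, map_mul]⟩
  · rintro ⟨s, t, ht, rfl, rfl, h⟩
    exact ⟨isDiag_diagGL s, hr.diagGL_mem_centralizerGL ht, by rw [h, map_diagGL, map_mul]⟩

theorem cohomologyClass_eq_iff {X Y : Matrix.SpecialLinearGroup (Fin n) L}
    (hX : X ∈ cocycles F r) (hY : Y ∈ cocycles F r) :
    cohomologyClass F r X hX = cohomologyClass F r Y hY ↔
      ∃ Q : Matrix.SpecialLinearGroup (Fin n) F, ∃ C ∈ centralizerSL r,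
        X = Matrix.SpecialLinearGroup.map (algebraMap F L) Q * Y * C :=
  Quotient.eq

/-- Two diagonal cocycles are equivalent if and only if their rational parts have the same
determinant up to determinants of rational elements of the centralizer. -/
theorem equivalent_iff_exists_compatible (hr : IsBDMatrix T r)
    {D D' : Matrix.SpecialLinearGroup (Fin n) L} {s s' : Fin n → Fˣ} {t t' : Fin n → Lˣ}
    (ht : t ∈ compatible T Lˣ) (ht' : t' ∈ compatible T Lˣ)
    (hD : Matrix.SpecialLinearGroup.toGL D = diagGL (mapTuple (algebraMap F L) s * t))
    (hD' : Matrix.SpecialLinearGroup.toGL D' = diagGL (mapTuple (algebraMap F L) s' * t')) :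
    (∃ Q : Matrix.SpecialLinearGroup (Fin n) F, ∃ C ∈ centralizerSL r,
        D = Matrix.SpecialLinearGroup.map (algebraMap F L) Q * D' * C) ↔
      ∃ m ∈ compatible T Fˣ, ∏ i, m i = (∏ i, s i) / ∏ i, s' i := by
  constructor
  · rintro ⟨Q, C, hC, h⟩
    obtain ⟨c, hc, hcC⟩ := hr.mem_centralizerGL_iff.1 hC
    have h := congrArg Matrix.SpecialLinearGroup.toGL h
    rw [map_mul, map_mul, toGL_map, hD, hD', ← hcC, mul_assoc, ← map_mul, ← mul_inv_eq_iff_eq_mul,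
      ← map_inv, ← map_mul] at h
    -- All other factors being diagonal, `Q` is diagonal as well.
    obtain ⟨q, hQ, hq⟩ := exists_diagGL_of_map h.symm
    have hdet : ∏ i, q i = 1 := by rw [← det_diagGL, ← hQ, det_toGL]
    -- Over `L` this rational tuple equals `t' c / t`, and compatibility descends to `F`.
    refine ⟨s / (s' * q), ?_, ?_⟩
    · rw [← mapTuple_mem_compatible_iff (algebraMap F L)]
      have : mapTuple (algebraMap F L) (s / (s' * q)) = t' * c / t := by
        rw [map_div, map_mul, div_eq_div_iff_mul_eq_mul, ← eq_mul_inv_iff_mul_eq.1 hq]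
        ac_rfl
      rw [this]
      exact div_mem (mul_mem ht' hc) ht
    · simp only [Pi.div_apply, Pi.mul_apply, Finset.prod_div_distrib, Finset.prod_mul_distrib,
        hdet, mul_one]
  · rintro ⟨m, hm, hprod⟩
    have hdet : ∀ {D : Matrix.SpecialLinearGroup (Fin n) L} {s : Fin n → Fˣ} {t : Fin n → Lˣ},
        Matrix.SpecialLinearGroup.toGL D = diagGL (mapTuple (algebraMap F L) s * t) →
        Units.map (algebraMap F L).toMonoidHom (∏ i, s i) = (∏ i, t i)⁻¹ := by
      intro D s t h
      have := det_toGL D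
      rw [h, det_diagGL] at this
      simp only [Pi.mul_apply, Finset.prod_mul_distrib, prod_mapTuple] at this
      exact eq_inv_of_mul_eq_one_left this
    -- With `Q = s / (s' m)` and `C = m t / t'`, the product `Q D' C` is `s t`; the condition on `∏
    -- m` is what gives both determinant `1`.
    obtain ⟨Q, hQ⟩ := exists_toGL_eq (X := diagGL (s / (s' * m))) (by
      rw [det_diagGL]
      simp [Finset.prod_div_distrib, Finset.prod_mul_distrib, hprod])
    obtain ⟨C, hC⟩ := exists_toGL_eq (X := diagGL (mapTuple (algebraMap F L) m * t / t')) (by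
      rw [det_diagGL]
      simp only [Pi.div_apply, Pi.mul_apply, Finset.prod_div_distrib, Finset.prod_mul_distrib,
        prod_mapTuple, hprod, map_div, hdet hD, hdet hD']
      simp)
    refine ⟨Q, C, ?_, toGL_injective ?_⟩
    · rw [centralizerSL, Subgroup.mem_comap, hC]
      exact hr.diagGL_mem_centralizerGL
        (div_mem (mul_mem ((mapTuple_mem_compatible_iff _).2 hm) ht) ht')
    · rw [map_mul, map_mul, toGL_map, hQ, hC, hD, hD', map_diagGL, ← map_mul, ← map_mul]
      congr 1
      rw [map_div, map_mul (mapTuple _)]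
      generalize mapTuple (algebraMap F L) s = x, mapTuple (algebraMap F L) s' = y,
        mapTuple (algebraMap F L) m = z
      rw [eq_comm, div_mul_eq_mul_div, div_mul_div_comm, div_eq_iff_eq_mul]
      ac_rfl

theorem exists_mapTuple_eq [IsGalois F L] {t : Fin n → Lˣ}
    (ht : ∀ σ : L ≃ₐ[F] L, mapTuple (σ : L →+* L) t = t) :
    ∃ s, mapTuple (algebraMap F L) s = t := by
  have h : ∀ i, ∃ x : F, algebraMap F L x = t i := fun i =>
    (InfiniteGalois.mem_range_algebraMap_iff_fixed (t i).1).2 fun σ =>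
      congrArg Units.val (congrFun (ht σ) i)
  choose x hx using h
  have hx0 : ∀ i, x i ≠ 0 := fun i h0 => (t i).ne_zero (by rw [← hx, h0, map_zero])
  exact ⟨fun i => Units.mk0 (x i) (hx0 i), funext fun i => Units.ext (hx i)⟩

/-- A cocycle is a rational matrix times a diagonal matrix. -/
theorem exists_eq_map_mul_diagGL [IsGalois F L] {X : GL (Fin n) L} {c : (L ≃ₐ[F] L) → Fin n → Lˣ}
    (hX : ∀ σ : L ≃ₐ[F] L, Matrix.GeneralLinearGroup.map (σ : L →+* L) X = X * diagGL (c σ)) :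
    ∃ (Q : GL (Fin n) F) (d : Fin n → Lˣ),
      X = Matrix.GeneralLinearGroup.map (algebraMap F L) Q * diagGL d := by
  have hcol : ∀ j, ∃ i, X.1 i j ≠ 0 := by
    intro j
    by_contra! h
    exact X.det.ne_zero (Matrix.det_eq_zero_of_column_eq_zero j h)
  choose p hp using hcol
  let d : Fin n → Lˣ := fun j => Units.mk0 _ (hp j)
  have hσ : ∀ (σ : L ≃ₐ[F] L) i j, σ (X.1 i j) = X.1 i j * c σ j := by
    intro σ i j
    have h := Matrix.GeneralLinearGroup.ext_iff _ _ |>.1 (hX σ) i j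
    rw [Units.val_mul, coe_diagGL, Matrix.mul_diagonal] at h
    exact h
  -- Each `σ` scales the whole column `j` by `c σ j`, so quotients within a column are Galois
  -- invariant.
  have hfix : ∀ i j, ∃ y : F, algebraMap F L y = X.1 i j / X.1 (p j) j := by
    intro i j
    refine (InfiniteGalois.mem_range_algebraMap_iff_fixed _).2 fun σ => ?_
    rw [map_div₀, hσ, hσ, mul_div_mul_right _ _ (c σ j).ne_zero]
  choose y hy using hfix
  let Y : Matrix (Fin n) (Fin n) F := Matrix.of y
  have hY : Y.map (algebraMap F L) = (X * diagGL d⁻¹).1 := by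
    ext i j
    rw [Units.val_mul, coe_diagGL, Matrix.mul_diagonal, Matrix.map_apply,
      show Y i j = y i j from rfl, hy, div_eq_mul_inv]
    simp [d]
  have hdet : Y.det ≠ 0 := by
    intro h0
    have h := (algebraMap F L).map_det Y
    rw [h0, map_zero, RingHom.mapMatrix_apply, hY] at h
    exact (X * diagGL d⁻¹).det.ne_zero h.symm
  refine ⟨Matrix.GeneralLinearGroup.mkOfDetNeZero Y hdet, d, ?_⟩
  rw [← mul_inv_eq_iff_eq_mul, ← map_inv]
  exact Units.ext hY.symm

/-- A diagonal cocycle is the product of a rational diagonal matrix and an element of the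
centralizer. -/
theorem exists_eq_mapTuple_mul [IsGalois F L] (hn : 0 < n) {d : Fin n → Lˣ}
    (hd : ∀ σ : L ≃ₐ[F] L, d⁻¹ * mapTuple (σ : L →+* L) d ∈ compatible T Lˣ) :
    ∃ s : Fin n → Fˣ, ∃ t ∈ compatible T Lˣ, d = mapTuple (algebraMap F L) s * t := by
  let u : Fin (n - 1) → Lˣ := fun a => d (lo a) / d (hi a)
  -- Replacing each ratio by the one at the start of its string makes the tuple compatible.
  let t : Fin n → Lˣ := ofRatios (d ⟨n - 1, by omega⟩) fun a => u (T.start a)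
  have ht : t ∈ compatible T Lˣ := ofRatios_mem_compatible _ fun a => by rw [T.start_tau]
  have hdt : d / t = ofRatios 1 fun a => u a / u (T.start a) := by
    nth_rw 1 [exists_eq_ofRatios hn d]
    ext i
    simp [t, ofRatios, u, mul_div_mul_left_eq_div]
  have hfix : ∀ σ : L ≃ₐ[F] L, mapTuple (σ : L →+* L) (d / t) = d / t := by
    intro σ
    rw [hdt, mapTuple_ofRatios, map_one]
    congr 1
    funext a
    -- The factor by which `σ` changes `u a` is constant on strings, so `u a / u (T.start a)` is
    -- Galois invariant.
    let ρ : Fin (n - 1) → Lˣ := fun a => Units.map (σ : L →+* L).toMonoidHom (u a) / u a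
    have hρ : ∀ a : T.Γ₁, ρ (T.τ a) = ρ a := by
      intro a
      have h := hd σ a
      simp only [Pi.mul_apply, Pi.inv_apply, mapTuple_apply, mul_div_mul_comm, ← map_div,
        inv_div_inv] at h
      simpa only [ρ, u, div_eq_mul_inv, mul_inv, inv_inv, mul_comm] using h
    have h : ρ (T.start a) = ρ a := T.apply_start hρ a
    rw [map_div, div_eq_div_iff_mul_eq_mul]
    exact (div_eq_div_iff_mul_eq_mul.1 h.symm).trans (mul_comm _ _)
  obtain ⟨s, hs⟩ := exists_mapTuple_eq hfix
  exact ⟨s, t, ht, by rw [hs, div_mul_cancel]⟩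

theorem exists_isFactorization [IsGalois F L] (hn : 0 < n) (hr : IsBDMatrix T r)
    {X : Matrix.SpecialLinearGroup (Fin n) L} (hX : X ∈ cocycles F r) :
    ∃ (D : Matrix.SpecialLinearGroup (Fin n) L) (hD : D ∈ cocycles F r)
      (A₁ : GL (Fin n) F) (A₂ : GL (Fin n) L),
      cohomologyClass F r D hD = cohomologyClass F r X hX ∧ D.1.IsDiag ∧
        IsFactorization r D A₁ A₂ := by
  have h := mem_cocycles_iff.1 hX
  simp only [hr.mem_centralizerGL_iff] at h
  choose c hc hcX using h
  have hσ : ∀ σ : L ≃ₐ[F] L, Matrix.GeneralLinearGroup.map (σ : L →+* L)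
      (Matrix.SpecialLinearGroup.toGL X) = Matrix.SpecialLinearGroup.toGL X * diagGL (c σ) :=
    fun σ => by rw [hcX, mul_inv_cancel_left]
  obtain ⟨Q, d, hQ⟩ := exists_eq_map_mul_diagGL hσ
  obtain ⟨s, t, ht, rfl⟩ := exists_eq_mapTuple_mul (T := T) (d := d) hn fun σ => by
    have h := hσ σ
    rw [hQ, map_mul, map_algEquiv_map_algebraMap, map_diagGL, mul_assoc, mul_right_inj,
      ← map_mul] at h
    rw [diagGL_injective h, inv_mul_cancel_left]
    exact hc σ
  -- The determinant of `Q` is moved into the first diagonal entry, so that the left factor lies in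
  -- `SL(n, F)`.
  set δ : Fin n → Fˣ := Pi.mulSingle ⟨0, hn⟩ (Matrix.GeneralLinearGroup.det Q) with hδ
  have hδdet : ∏ i, δ i = Matrix.GeneralLinearGroup.det Q := by
    rw [Finset.prod_eq_single ⟨0, hn⟩] <;> simp +contextual [hδ]
  obtain ⟨Q', hQ'⟩ := exists_toGL_eq (X := Q * diagGL δ⁻¹) (by
    rw [map_mul, det_diagGL]
    simp [hδdet])
  have hX' : Matrix.SpecialLinearGroup.toGL X =
      Matrix.SpecialLinearGroup.toGL (Matrix.SpecialLinearGroup.map (algebraMap F L) Q') *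
        diagGL (mapTuple (algebraMap F L) (δ * s) * t) := by
    rw [toGL_map, hQ', map_mul, map_diagGL, mul_assoc, ← map_mul, hQ, map_mul, map_inv]
    simp [mul_assoc]
  obtain ⟨D, hD⟩ := exists_toGL_eq (X := diagGL (mapTuple (algebraMap F L) (δ * s) * t)) (by
    have h := congrArg Matrix.GeneralLinearGroup.det hX'
    rwa [map_mul, det_toGL, det_toGL, one_mul, eq_comm] at h)
  have hDc := mem_cocycles_of_eq_diagGL (F := F) hr ht hD
  refine ⟨D, hDc, diagGL (δ * s), diagGL t, ?_, ?_,
    hr.isFactorization_iff.2 ⟨_, t, ht, rfl, rfl, hD⟩⟩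
  · refine Eq.symm ((cohomologyClass_eq_iff _ _).2 ⟨Q', 1, one_mem _, toGL_injective ?_⟩)
    rw [mul_one, map_mul, hX', hD]
  · have := isDiag_diagGL (mapTuple (algebraMap F L) (δ * s) * t)
    rwa [← hD] at this

theorem cohomologyClass_eq_iff_det (hn : 0 < n) (hr : IsBDMatrix T r)
    {D₁ D₂ : Matrix.SpecialLinearGroup (Fin n) L} {A₁ B₁ : GL (Fin n) F} {A₂ B₂ : GL (Fin n) L}
    (hA : IsFactorization r D₁ A₁ A₂) (hB : IsFactorization r D₂ B₁ B₂) :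
    ∃ (h₁ : D₁ ∈ cocycles F r) (h₂ : D₂ ∈ cocycles F r),
      (cohomologyClass F r D₁ h₁ = cohomologyClass F r D₂ h₂ ↔
        (QuotientGroup.mk (Matrix.GeneralLinearGroup.det A₁) :
            Fˣ ⧸ powerSubgroup F T.stringGcd) =
          QuotientGroup.mk (Matrix.GeneralLinearGroup.det B₁)) := by
  obtain ⟨s, t, ht, rfl, rfl, hD₁⟩ := hr.isFactorization_iff.1 hA
  obtain ⟨s', t', ht', rfl, rfl, hD₂⟩ := hr.isFactorization_iff.1 hB
  refine ⟨mem_cocycles_of_eq_diagGL hr ht hD₁, mem_cocycles_of_eq_diagGL hr ht' hD₂, ?_⟩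
  rw [cohomologyClass_eq_iff, equivalent_iff_exists_compatible hr ht ht' hD₁ hD₂,
    exists_mem_compatible_prod_eq T hn, QuotientGroup.eq_iff_div_mem, det_diagGL, det_diagGL]
  rfl

/-- The bijection sends a class to `det A₁` for a chosen factorization of a representative;
`cohomologyClass_eq_iff_det` makes the result independent of that choice. -/
theorem card_cohomology [IsGalois F L] [IsAlgClosed L] (hn : 0 < n) (hr : IsBDMatrix T r) :
    Nat.card (Cohomology F r) = Nat.card (Fˣ ⧸ powerSubgroup F T.stringGcd) := by
  have hex : ∀ x : Cohomology F r, ∃ (D : Matrix.SpecialLinearGroup (Fin n) L)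
      (hD : D ∈ cocycles F r) (A₁ : GL (Fin n) F) (A₂ : GL (Fin n) L),
      cohomologyClass F r D hD = x ∧ IsFactorization r D A₁ A₂ := by
    rintro ⟨X, hX⟩
    obtain ⟨D, hD, A₁, A₂, h, -, h'⟩ := exists_isFactorization hn hr hX
    exact ⟨D, hD, A₁, A₂, h, h'⟩
  choose D hD A₁ A₂ hclass hfact using hex
  refine Nat.card_eq_of_bijective
    (fun x => (QuotientGroup.mk (Matrix.GeneralLinearGroup.det (A₁ x)) :
      Fˣ ⧸ powerSubgroup F T.stringGcd)) ⟨fun x y hxy => ?_, fun z => ?_⟩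
  · obtain ⟨_, _, h⟩ := cohomologyClass_eq_iff_det hn hr (hfact x) (hfact y)
    rw [← hclass x, ← hclass y]
    exact h.2 hxy
  · obtain ⟨δ, rfl⟩ := QuotientGroup.mk_surjective z
    -- To realize `δ`, take `diag(δ, 1, …, 1)` times the scalar `e` with `e ^ n = δ⁻¹`: scalars are
    -- compatible and the determinant becomes `1`.
    obtain ⟨e, he⟩ := IsAlgClosed.exists_pow_nat_eq (algebraMap F L (δ⁻¹ : Fˣ)) hn
    have he0 : e ≠ 0 := by
      rintro rfl
      rw [zero_pow hn.ne', eq_comm, map_eq_zero] at he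
      exact (δ⁻¹).ne_zero he
    have he' : Units.mk0 e he0 ^ n = Units.map (algebraMap F L).toMonoidHom δ⁻¹ := Units.ext he
    let s : Fin n → Fˣ := Pi.mulSingle ⟨0, hn⟩ δ
    have hs : ∏ i, s i = δ := by
      rw [Finset.prod_eq_single ⟨0, hn⟩] <;> simp +contextual [s]
    let t : Fin n → Lˣ := fun _ => Units.mk0 e he0
    have ht : t ∈ compatible T Lˣ := fun a => by simp [t]
    obtain ⟨E, hE⟩ := exists_toGL_eq (X := diagGL (mapTuple (algebraMap F L) s * t)) (by
      rw [det_diagGL]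
      simp only [Pi.mul_apply, Finset.prod_mul_distrib, prod_mapTuple, hs, t, Finset.prod_const,
        Finset.card_univ, Fintype.card_fin, he']
      simp)
    have hEf := hr.isFactorization_iff.2 ⟨s, t, ht, rfl, rfl, hE⟩
    have hEc := mem_cocycles_of_eq_diagGL (F := F) hr ht hE
    refine ⟨cohomologyClass F r E hEc, ?_⟩
    obtain ⟨_, _, h⟩ := cohomologyClass_eq_iff_det hn hr (hfact (cohomologyClass F r E hEc)) hEf
    rw [det_diagGL, hs] at h
    exact h.1 (hclass _)

end Cocycles

end BelavinDrinfeld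
end

open BelavinDrinfeld TensorProduct in
theorem mainTheorem1 (n : ℕ) (hn : 2 ≤ n) (T : AdmissibleTriple n)
    (r : Matrix (Fin n) (Fin n) Kbar ⊗[Kbar] Matrix (Fin n) (Fin n) Kbar)
    (hr : IsBDMatrix T r) :
    Nat.card (Cohomology K r) = T.stringGcd ∧
    (∀ x : Cohomology K r, ∃ (D : Matrix.SpecialLinearGroup (Fin n) Kbar) (hD : D ∈ cocycles K r)
      (A₁ : GL (Fin n) K) (A₂ : GL (Fin n) Kbar),
      cohomologyClass K r D hD = x ∧ D.1.IsDiag ∧ IsFactorization r D A₁ A₂) ∧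
    (∀ (D₁ D₂ : Matrix.SpecialLinearGroup (Fin n) Kbar) (A₁ B₁ : GL (Fin n) K)
      (A₂ B₂ : GL (Fin n) Kbar),
      IsFactorization r D₁ A₁ A₂ → IsFactorization r D₂ B₁ B₂ →
      ∃ (h₁ : D₁ ∈ cocycles K r) (h₂ : D₂ ∈ cocycles K r),
        (cohomologyClass K r D₁ h₁ = cohomologyClass K r D₂ h₂ ↔
          (QuotientGroup.mk (Matrix.GeneralLinearGroup.det A₁) :
              Kˣ ⧸ powerSubgroup K T.stringGcd) =
            QuotientGroup.mk (Matrix.GeneralLinearGroup.det B₁))) := by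
  have hn0 : 0 < n := by omega
  -- Characteristic zero makes `Kbar` a Galois extension of `K`.
  have : CharZero K := charZero_of_injective_algebraMap (algebraMap ℂ K).injective
  refine ⟨?_, ?_, ?_⟩
  · rw [card_cohomology hn0 hr]
    exact card_units_laurentSeries_quotient ℂ (Nat.gcd_pos_of_pos_left _ hn0)
  · rintro ⟨X, hX⟩
    exact exists_isFactorization hn0 hr hX
  · intro D₁ D₂ A₁ B₁ A₂ B₂ hA hB
    exact cohomologyClass_eq_iff_det hn0 hr hA hB
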